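/- Let $T^2=S^1\times S^1$. A telescoping triple $(Z,T_1,T_2)$ consists of a connected symplectic $4$-manifold $Z$ and two disjoint smoothly embedded Lagrangian tori $T_1,T_2\subset Z$ such that 1. the classes of $T_1$ and $T_2$ span a $2$-dimensional subspace of $H_2(Z;\mathbb{R})$; 2. $\pi_1(Z)\cong\mathbb{Z}^2$, and the meridians of $T_1$ and of $T_2$ are trivial in $\pi_1(Z\setminus(T_1\cup T_2))$; 3. the image of $\pi_1(T_1)\to\pi_1(Z)$ is infinite cyclic and is a direct summand of $\pi_1(Z)$; 4. $\pi_1(T_2)\to\pi_1(Z)$ is an isomorphism. Let $T$ be an embedded torus in a $4$-manifold $X$ with a framing $\nu T\cong T^2\times D^2$ of a tubular neighbourhood (restricting to the given parametrization $T\cong T^2\times\{0\}$), let $\mu$ be its meridian $\{pt\}\times\partial D^2$, let $\gamma$ be a primitive curve on $T$, i.e. a smoothly embedded closed curve that is homotopic to a $k$-fold multiple of a closed curve only if $k=\pm1$, and let $\gamma'=\gamma\times\{pt\}\subset\partial\nu T$ be its push-off along the framing. A $p/q$-surgery on $T$ along $\gamma$ replaces $X$ by $(X\setminus\nu T)\cup_\varphi(T^2\times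 D^2)$, where $\varphi\colon T^2\times S^1\to\partial\nu T$ is any diffeomorphism with $\varphi_*[\{pt\}\times S^1]=p[\mu]+q[\gamma']$ in $H_1(\partial\nu T;\mathbb{Z})$. **Proposition.** Let $(Z,T_1,T_2)$ be a telescoping triple. Then there are primitive curves $\gamma_1$ on $T_1$ and $\gamma_2$ on $T_2$ with the following property. Gluing diffeomorphisms for $1/1$-surgery along $\gamma_1$ and for $1/2$-surgery along $\gamma_2$ exist, and, for all framings of $T_1$ and $T_2$ with disjoint images and all such gluing diffeomorphisms, performing $1/1$-surgery on $T_1$ along $\gamma_1$ and $1/2$-surgery on $T_2$ along $\gamma_2$ gives a connected smooth $4$-manifold whose fundamental group is isomorphic to $\mathbb{Z}/2$. -/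

import Mathlib

open Set Topology Manifold ContDiff

universe u

noncomputable section

/-- The standard torus `T² = S¹ × S¹`. -/
abbrev Torus : Type := Circle × Circle

/-- The smooth structure of `T²` is modelled on `ℝ¹ × ℝ¹`. -/
abbrev torusModel : ModelWithCorners ℝ (EuclideanSpace ℝ (Fin 1) × EuclideanSpace ℝ (Fin 1))
    (ModelProd (EuclideanSpace ℝ (Fin 1)) (EuclideanSpace ℝ (Fin 1))) :=
  (𝓡 1).prod (𝓡 1)

section Symplectic

variable {X : Type u} [TopologicalSpace X] [ChartedSpace (EuclideanSpace ℝ (Fin 4)) X]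

/-- The expression of a 2-form on a 4-manifold in the preferred chart around `x₀`, i.e. its
pull-back under the inverse of the chart (meaningful on the target of the chart). -/
def formInChart (Ω : ∀ x : X, TangentSpace (𝓡 4) x [⋀^Fin 2]→L[ℝ] ℝ) (x₀ : X)
    (y : EuclideanSpace ℝ (Fin 4)) : EuclideanSpace ℝ (Fin 4) [⋀^Fin 2]→L[ℝ] ℝ :=
  (Ω ((extChartAt (𝓡 4) x₀).symm y)).compContinuousLinearMap
    (mfderiv (𝓡 4) (𝓡 4) (extChartAt (𝓡 4) x₀).symm y)

/-- A symplectic form on a 4-manifold: a smooth, closed, nondegenerate 2-form. -/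
structure IsSymplecticForm (Ω : ∀ x : X, TangentSpace (𝓡 4) x [⋀^Fin 2]→L[ℝ] ℝ) : Prop where
  smooth : ∀ x₀ : X, ContDiffOn ℝ ∞ (formInChart Ω x₀) (extChartAt (𝓡 4) x₀).target
  closed : ∀ x₀ : X, ∀ y ∈ (extChartAt (𝓡 4) x₀).target, extDeriv (formInChart Ω x₀) y = 0
  nondegenerate : ∀ (x : X) (v : TangentSpace (𝓡 4) x),
    v ≠ 0 → ∃ w : TangentSpace (𝓡 4) x, Ω x ![v, w] ≠ 0

/-- A smoothly embedded torus on which the 2-form `Ω` vanishes. -/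
structure IsLagrangianTorus (Ω : ∀ x : X, TangentSpace (𝓡 4) x [⋀^Fin 2]→L[ℝ] ℝ)
    (T : C(Torus, X)) : Prop where
  embedding : IsSmoothEmbedding torusModel (𝓡 4) ∞ T
  isotropic : ∀ (t : Torus) (v w : TangentSpace torusModel t),
    Ω (T t) ![mfderiv torusModel (𝓡 4) T t v, mfderiv torusModel (𝓡 4) T t w] = 0

end Symplectic

section Homology

variable {X : Type u} [TopologicalSpace X]

/-- The map induced by `T : T² → X` on singular homology `H₂( · ; ℝ)`. (The `ULift`s only move
`T²` and `ℝ` to the universe of `X`.) -/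
def torusHomologyMap (T : C(Torus, X)) :=
  ((AlgebraicTopology.singularHomologyFunctor (ModuleCat.{u} ℝ) 2).obj
    (ModuleCat.of ℝ (ULift.{u} ℝ))).map
      (TopCat.ofHom (T.comp (⟨ULift.down, continuous_uliftDown⟩ : C(ULift.{u} Torus, Torus))))

/-- The span in `H₂(X; ℝ)` of the class of the torus `T`. Since `H₂(T²; ℝ)` is the line spanned
by the fundamental class of `T²`, this is the image of the induced map. -/
def torusClassSpan (T : C(Torus, X)) :=
  LinearMap.range (torusHomologyMap T).hom

end Homology

section Exterior

variable {X : Type u} [TopologicalSpace X] [T2Space X] {ι : Type} [Finite ι]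

/-- The complement `X - ⋃ i, T i` of finitely many tori, as an open subset of `X`. -/
def exterior (T : ι → C(Torus, X)) : TopologicalSpace.Opens X where
  carrier := (⋃ i, range (T i))ᶜ
  is_open' := (isClosed_iUnion_of_finite
    fun i => (isCompact_range (T i).continuous).isClosed).isOpen_compl

/-- A loop `m` in the complement of the tori `T j` is a meridian of `T i` if it is the boundary
circle of a smooth disc in `X` whose centre lies on `T i`, which is transverse to `T i` there,
and which otherwise misses all of the tori. (The disc is given with a smooth extension
to the plane.) -/
def IsMeridian [ChartedSpace (EuclideanSpace ℝ (Fin 4)) X] (T : ι → C(Torus, X)) (i : ι)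
    (m : C(Circle, exterior T)) : Prop :=
  ∃ d : C(ℂ, X), ContMDiff 𝓘(ℝ, ℂ) (𝓡 4) ∞ d ∧
    (∃ t : Torus, T i t = d 0 ∧
      let A : TangentSpace torusModel t →ₗ[ℝ] EuclideanSpace ℝ (Fin 4) :=
        (mfderiv torusModel (𝓡 4) (T i) t).toLinearMap
      let B : TangentSpace 𝓘(ℝ, ℂ) (0 : ℂ) →ₗ[ℝ] EuclideanSpace ℝ (Fin 4) :=
        (mfderiv 𝓘(ℝ, ℂ) (𝓡 4) d 0).toLinearMap
      LinearMap.range A ⊔ LinearMap.range B = ⊤) ∧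
    (∀ z : ℂ, z ≠ 0 → d z ∈ exterior T) ∧
    ∀ s : Circle, (m s : X) = d (s : ℂ)

end Exterior

/-- Telescoping triples `(X, T₁, T₂)`, for a 4-manifold `X` with a 2-form `Ω`. -/
structure IsTelescopingTriple {X : Type u} [TopologicalSpace X] [T2Space X]
    [ChartedSpace (EuclideanSpace ℝ (Fin 4)) X]
    (Ω : ∀ x : X, TangentSpace (𝓡 4) x [⋀^Fin 2]→L[ℝ] ℝ) (T₁ T₂ : C(Torus, X)) : Prop where
  symplectic : IsSymplecticForm Ω
  lagrangian₁ : IsLagrangianTorus Ω T₁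
  lagrangian₂ : IsLagrangianTorus Ω T₂
  disjoint : Disjoint (range T₁) (range T₂)
  /-- The classes of `T₁` and `T₂` span a 2-dimensional subspace of `H₂(X; ℝ)`. -/
  finrank_span : Module.finrank ℝ ↥(torusClassSpan T₁ ⊔ torusClassSpan T₂) = 2
  /-- `π₁(X) ≅ ℤ²`. -/
  fundamentalGroup : ∀ x : X, Nonempty (FundamentalGroup X x ≃* Multiplicative (ℤ × ℤ))
  /-- The meridians of both tori are trivial in `π₁(X - (T₁ ∪ T₂))`. -/
  meridian : ∀ (i : Fin 2) (m : C(Circle, exterior ![T₁, T₂])),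
    IsMeridian ![T₁, T₂] i m → m.Nullhomotopic
  /-- The image of `π₁(T₁) → π₁(X)` is infinite cyclic, and a direct summand. -/
  range_cyclic : Nonempty ((FundamentalGroup.map T₁ 1).range ≃* Multiplicative ℤ)
  range_summand : ∃ K : Subgroup (FundamentalGroup X (T₁ 1)),
    IsCompl (FundamentalGroup.map T₁ 1).range K
  /-- `π₁(T₂) → π₁(X)` is an isomorphism. -/
  bijective : Function.Bijective (FundamentalGroup.map T₂ 1)

section Curves

/-- The `k`-th power map of the circle. -/
def circlePow (k : ℤ) : C(Circle, Circle) := ⟨fun s => s ^ k, continuous_zpow k⟩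

/-- A primitive curve on the torus: a smoothly embedded closed curve which is not homotopic to
a `k`-fold multiple of a closed curve unless `k = ±1`. -/
structure IsPrimitiveCurve (γ : C(Circle, Torus)) : Prop where
  embedding : IsSmoothEmbedding (𝓡 1) torusModel ∞ γ
  primitive : ∀ (δ : C(Circle, Torus)) (k : ℤ), γ.Homotopic (δ.comp (circlePow k)) → IsUnit k

/-- Self-diffeomorphisms of `T² × S¹`. -/
abbrev TorusGluing : Type :=
  Diffeomorph (torusModel.prod (𝓡 1)) (torusModel.prod (𝓡 1)) (Torus × Circle) (Torus × Circle) ∞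

/-- In `T² × S¹`, let `μ` be the circle `{pt} × S¹` and `γ × {pt}` the push-off of the curve `γ`.
The gluing map `φ` is one for a `p/q`-surgery along `γ` if `φ({pt} × S¹)` represents
`p [μ] + q [γ]`. As `π₁(T² × S¹)` is abelian, closed curves there are homologous if and only if
they are freely homotopic; the class `p [μ] + q [γ]` is that of `s ↦ (γ(s^q), s^p)`. -/
def IsSurgeryGluing (p q : ℤ) (γ : C(Circle, Torus)) (φ : TorusGluing) : Prop :=
  ContinuousMap.Homotopic
    (⟨fun s => φ (1, s), by have := φ.continuous; fun_prop⟩ : C(Circle, Torus × Circle))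
    ((γ.comp (circlePow q)).prodMk (circlePow p))

end Curves

section Surgery

variable {X : Type u} [TopologicalSpace X]

/-- The core torus `T² × {0}` of a map `T² × ℂ → X`. -/
def core (F : C(Torus × ℂ, X)) : C(Torus, X) :=
  F.comp ⟨fun t => (t, 0), by fun_prop⟩

/-- A framing of the embedded torus `T`: a diffeomorphism `F` from `T² × ℂ` onto an open
neighbourhood of `T` which is `T` on `T² × {0}`. The framed tubular neighbourhood `ν T` is
`F (T² × D²)`, with `D² ⊆ ℂ` the unit disc, and `∂ν T` is `F (T² × S¹)`. -/
structure IsFraming [ChartedSpace (EuclideanSpace ℝ (Fin 4)) X] (T : C(Torus, X))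
    (F : C(Torus × ℂ, X)) : Prop where
  isOpenEmbedding : IsOpenEmbedding F
  isLocalDiffeomorph : IsLocalDiffeomorph (torusModel.prod 𝓘(ℝ, ℂ)) (𝓡 4) ∞ F
  core_eq : core F = T

variable [T2Space X] {ι : Type} [Finite ι]

/-- The identifications made by torus surgery: the gluing map `φ i : T² × S¹ → T² × S¹ = ∂ν(T i)`
is extended radially, so that `(x, r s)` in the `i`-th new piece, with `r > 0` and `s ∈ S¹`, is
glued to the point `F i (x', r s')` of the complement, where `(x', s') = φ i (x, s)`. -/
inductive SurgeryRel (F : ι → C(Torus × ℂ, X)) (φ : ι → TorusGluing) :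
    ↥(exterior fun i => core (F i)) ⊕ (Σ _ : ι, Torus × ℂ) →
    ↥(exterior fun i => core (F i)) ⊕ (Σ _ : ι, Torus × ℂ) → Prop
  | glue (i : ι) (x : Torus) (s : Circle) (r : ℝ) (hr : 0 < r)
      (y : ↥(exterior fun i => core (F i)))
      (hy : (y : X) = F i ((φ i (x, s)).1, (r : ℂ) * ((φ i (x, s)).2 : ℂ))) :
      SurgeryRel F φ (Sum.inr ⟨i, (x, (r : ℂ) * (s : ℂ))⟩) (Sum.inl y)

/-- The result of cutting out neighbourhoods of the cores of the framings `F i` and gluing in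
copies of `T² × D²` along the `φ i`. This is `(X - ⋃ ν(T i)) ∪ ⋃ (T² × D²)`, glued along the
boundaries `∂ν(T i)`, with an open collar added to each side so that the pieces are glued along
open subsets: the complement of the tori `T i` and copies of `T² × ℂ` are glued
along `T² × (ℂ ∖ 0)`. -/
def TorusSurgery (F : ι → C(Torus × ℂ, X)) (φ : ι → TorusGluing) : Type u :=
  Quot (SurgeryRel F φ)

instance (F : ι → C(Torus × ℂ, X)) (φ : ι → TorusGluing) :
    TopologicalSpace (TorusSurgery F φ) :=
  inferInstanceAs (TopologicalSpace (Quot (SurgeryRel F φ)))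

namespace TorusSurgery

/-- The inclusion of the complement of the surgered tori. -/
def inl (F : ι → C(Torus × ℂ, X)) (φ : ι → TorusGluing)
    (y : ↥(exterior fun i => core (F i))) : TorusSurgery F φ :=
  Quot.mk _ (Sum.inl y)

/-- The inclusion of the `i`-th new piece. -/
def inr (F : ι → C(Torus × ℂ, X)) (φ : ι → TorusGluing) (i : ι)
    (z : Torus × ℂ) : TorusSurgery F φ :=
  Quot.mk _ (Sum.inr ⟨i, z⟩)

/-- The surgered space is a connected smooth 4-manifold: it is connected, Hausdorff, second
countable, and has a smooth atlas for which the inclusions of all pieces are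
local diffeomorphisms. -/
structure IsSmoothFourManifold [ChartedSpace (EuclideanSpace ℝ (Fin 4)) X]
    (F : ι → C(Torus × ℂ, X)) (φ : ι → TorusGluing) : Prop where
  connected : ConnectedSpace (TorusSurgery F φ)
  hausdorff : T2Space (TorusSurgery F φ)
  secondCountable : SecondCountableTopology (TorusSurgery F φ)
  smooth : ∃ _ : ChartedSpace (EuclideanSpace ℝ (Fin 4)) (TorusSurgery F φ),
    IsManifold (𝓡 4) ∞ (TorusSurgery F φ) ∧
    IsLocalDiffeomorph (𝓡 4) (𝓡 4) ∞ (inl F φ) ∧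
    ∀ i, IsLocalDiffeomorph (torusModel.prod 𝓘(ℝ, ℂ)) (𝓡 4) ∞ (inr F φ i)

end TorusSurgery

end Surgery

end

/-! Let `A` be the complement of the two tori. Both `X` and the surgered space arise from `A` by
gluing in two copies of `T² × ℂ` along `T² × (ℂ ∖ 0)`; only the gluing maps differ. By van Kampen's
theorem such a filling divides `π₁(A)` by the normal closure of the boundary circles of the fibres.
For `X` these circles are meridians, which are trivial in `π₁(A)`, so `π₁(A) → π₁(X) ≅ ℤ²` is an
isomorphism. For the surgered space they are the curves `φ({pt} × S¹)`, and their classes may be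
computed in `X`: there the push-off shrinks to the core and the meridian dies, so `p/q`-surgery
along `γ` kills `γ ^ q`, whatever the framing and the gluing map. The new group is therefore `ℤ² /
⟨[γ₁], 2[γ₂]⟩`.

For `γ₁` take a curve on `T₁` mapping to a generator of the image of `π₁(T₁)`. As the image is
infinite cyclic and a direct summand, `γ₁` is primitive on `T₁` and its class is primitive in `ℤ²`.
As `π₁(T₂) → π₁(X)` is an isomorphism, a class completing `[γ₁]` to a basis is carried by a
primitive curve `γ₂` on `T₂` (`PathHom.exists_adapted`). The quotient is `ℤ² / ⟨(1, 0), (0, 2)⟩ =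
ℤ/2`.

Van Kampen's theorem enters as a universal property of functors from the fundamental groupoid to a
group (`PathHom`, `exists_pathHom_of_isLocalPathHom`). This needs no base points, so both tori are
treated at once although the overlap of the pieces is disconnected. `IsFilling.exists_pathHom`
extends functors over a filling, `IsFilling.exists_path_map_homotopic` pushes paths off the cores,
and together they give `IsFilling.nonempty_fundamentalGroup_mulEquiv`.
`TorusSurgery.loop_fibreCircle_gluing` computes the classes that are killed.

The manifold structure comes from extending each gluing map radially to a diffeomorphism off the
zero section; the Hausdorff property holds because closed tubes are compact. -/

open unitInterval

noncomputable section

/-! ### Path homomorphisms, global and local -/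

/-- A homotopy-invariant multiplicative function on the paths of `Y`, i.e. a functor from the
fundamental groupoid of `Y` to the one-object groupoid of `H`. -/
structure PathHom (Y : Type*) [TopologicalSpace Y] (H : Type*) [Group H] where
  /-- The value on a path. -/
  toFun : C(I, Y) → H
  map_trans' : ∀ {x y z : Y} (p : Path x y) (q : Path y z),
    toFun (p.trans q).toContinuousMap = toFun q.toContinuousMap * toFun p.toContinuousMap
  map_homotopic' : ∀ {x y : Y} {p q : Path x y}, p.Homotopic q →
    toFun p.toContinuousMap = toFun q.toContinuousMap

/-- A function on paths which is multiplicative and homotopy-invariant inside `U`. -/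
structure IsLocalPathHom {Y H : Type*} [TopologicalSpace Y] [Group H] (val : C(I, Y) → H)
    (U : Set Y) : Prop where
  map_trans : ∀ {x y z : Y} (p : Path x y) (q : Path y z), range p ⊆ U → range q ⊆ U →
    val (p.trans q).toContinuousMap = val q.toContinuousMap * val p.toContinuousMap
  map_homotopy : ∀ {x y : Y} {p q : Path x y} (F : p.Homotopy q), range F ⊆ U →
    val p.toContinuousMap = val q.toContinuousMap

/-- The image under `h` of the segment from `x` to `y`. -/
def segmentMap {E Y : Type*} [AddCommGroup E] [Module ℝ E] [TopologicalSpace E]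
    [ContinuousAdd E] [ContinuousSMul ℝ E] [TopologicalSpace Y] (h : C(E, Y)) (x y : E) : C(I, Y) :=
  h.comp (Path.segment x y).toContinuousMap

/-- The affine homotopy between two paths with the same end points. -/
def Path.Homotopy.ofAffine {E : Type*} [AddCommGroup E] [Module ℝ E] [TopologicalSpace E]
    [IsTopologicalAddGroup E] [ContinuousSMul ℝ E] {x y : E} (p q : Path x y) : p.Homotopy q where
  toHomotopy := ContinuousMap.Homotopy.affine p.toContinuousMap q.toContinuousMap
  prop' := by
    rintro t s (rfl | hs)
    · simp
    · obtain rfl : s = 1 := hs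
      simp

theorem Path.Homotopy.ofAffine_mem {E : Type*} [AddCommGroup E] [Module ℝ E] [TopologicalSpace E]
    [IsTopologicalAddGroup E] [ContinuousSMul ℝ E] {x y : E} (p q : Path x y) {C : Set E}
    (hC : Convex ℝ C) (hp : range p ⊆ C) (hq : range q ⊆ C) :
    range (Path.Homotopy.ofAffine p q) ⊆ C := by
  rintro _ ⟨⟨s, t⟩, rfl⟩
  have : Path.Homotopy.ofAffine p q (s, t) = Path.segment (p t) (q t) s := rfl
  rw [this]
  have h2 : Path.segment (p t) (q t) s ∈ range (Path.segment (p t) (q t)) := ⟨s, rfl⟩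
  rw [Path.range_segment] at h2
  exact hC.segment_subset (hp ⟨t, rfl⟩) (hq ⟨t, rfl⟩) h2

namespace IsLocalPathHom

variable {Y H : Type*} [TopologicalSpace Y] [Group H] {val : C(I, Y) → H} {U : Set Y}

section

variable {E : Type*} [AddCommGroup E] [Module ℝ E] [TopologicalSpace E]
  [IsTopologicalAddGroup E] [ContinuousSMul ℝ E]

/-- In a convex set the segment and the broken line are joined by the affine homotopy, which stays
in the set. This cocycle rule replaces all explicit homotopies in the gluing argument below. -/
theorem segment_trans (hval : IsLocalPathHom val U) (h : C(E, Y)) {C : Set E} (hC : Convex ℝ C)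
    (hU : ∀ x ∈ C, h x ∈ U) {x y z : E} (hx : x ∈ C) (hy : y ∈ C) (hz : z ∈ C) :
    val (segmentMap h x z) = val (segmentMap h y z) * val (segmentMap h x y) := by
  have key : ∀ {x y : E}, x ∈ C → y ∈ C → range (Path.segment x y) ⊆ C := by
    intro x y hx hy
    rw [Path.range_segment]
    exact hC.segment_subset hx hy
  have hrange : ∀ {x y : E}, x ∈ C → y ∈ C →
      range ((Path.segment x y).map h.continuous) ⊆ U := by
    rintro x y hx hy _ ⟨t, rfl⟩
    exact hU _ (key hx hy ⟨t, rfl⟩)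
  have h1 := hval.map_homotopy
    ((Path.Homotopy.ofAffine (Path.segment x z)
      ((Path.segment x y).trans (Path.segment y z))).map h) (by
      rintro _ ⟨t, rfl⟩
      refine hU _ (Path.Homotopy.ofAffine_mem _ _ hC (key hx hz) ?_ ⟨t, rfl⟩)
      rw [Path.trans_range]
      exact union_subset (key hx hy) (key hy hz))
  have h2 := hval.map_trans ((Path.segment x y).map h.continuous)
    ((Path.segment y z).map h.continuous) (hrange hx hy) (hrange hy hz)
  rw [← Path.map_trans] at h2
  exact h1.trans h2

theorem segment_self (hval : IsLocalPathHom val U) (h : C(E, Y)) {x : E} (hx : h x ∈ U) :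
    val (segmentMap h x x) = 1 := by
  have := hval.segment_trans h (convex_singleton x) (by simpa using hx) (mem_singleton x)
    (mem_singleton x) (mem_singleton x)
  simpa using this

end

theorem map_const (hval : IsLocalPathHom val U) {y : Y} (hy : y ∈ U) :
    val (.const I y) = 1 := by
  have := hval.map_trans (Path.refl y) (Path.refl y) (by simpa) (by simpa)
  rw [Path.refl_trans_refl] at this
  exact left_eq_mul.mp this

end IsLocalPathHom

/-! ### Extension of local path homomorphisms over an open cover -/

section Gluing

variable {Y H κ : Type*} [TopologicalSpace Y] [Group H] {val : C(I, Y) → H} {U : κ → Set Y}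

/-- A primitive along `γ` of a local path homomorphism. -/
def IsPathPotential (val : C(I, Y) → H) (U : κ → Set Y) (γ : C(ℝ, Y)) (f : ℝ → H) (T : ℝ) : Prop :=
  ∀ a b : ℝ, 0 ≤ a → a ≤ b → b ≤ T → ∀ k, (∀ s ∈ Icc a b, γ s ∈ U k) →
    f b = val (segmentMap γ a b) * f a

/-- The Lebesgue number lemma. The subdivision is an infinite sequence that is eventually constant,
which suits induction. -/
theorem exists_subdivision (hU : ∀ k, IsOpen (U k)) (hcov : ∀ y, ∃ k, y ∈ U k) (γ : C(ℝ, Y)) :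
    ∃ t : ℕ → ℝ, t 0 = 0 ∧ Monotone t ∧ (∀ n, 0 ≤ t n ∧ t n ≤ 1) ∧ (∃ n, t n = 1) ∧
      ∀ n, ∃ k, ∀ s ∈ Icc (t n) (t (n + 1)), γ s ∈ U k := by
  obtain ⟨t, h0, hm, ⟨N, hN⟩, hk⟩ := exists_monotone_Icc_subset_open_cover_unitInterval
    (c := fun k => {s : I | γ s ∈ U k}) (fun k => (hU k).preimage (by fun_prop))
    (fun s _ => by simpa using hcov (γ s))
  refine ⟨fun n => t n, by simp [h0], fun m n h => hm h, fun n => (t n).2, ⟨N, by simp [hN N]⟩,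
    fun n => ?_⟩
  obtain ⟨k, hk⟩ := hk n
  refine ⟨k, fun s hs => ?_⟩
  exact hk (a := ⟨s, (t n).2.1.trans hs.1, hs.2.trans (t (n + 1)).2.2⟩) hs

theorem exists_pathPotential (hval : ∀ k, IsLocalPathHom val (U k)) (hU : ∀ k, IsOpen (U k))
    (hcov : ∀ y, ∃ k, y ∈ U k) (γ : C(ℝ, Y)) : ∃ f, IsPathPotential val U γ f 1 := by
  obtain ⟨t, h0, hm, ht, ⟨N, hN⟩, hk⟩ := exists_subdivision hU hcov γ
  suffices ∀ n, ∃ f, IsPathPotential val U γ f (t n) by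
    obtain ⟨f, hf⟩ := this N
    exact ⟨f, hN ▸ hf⟩
  intro n
  induction n with
  | zero =>
    refine ⟨fun _ => 1, fun a b ha hab hb k hk => ?_⟩
    obtain rfl : a = b := by linarith
    rw [(hval k).segment_self γ (hk a ⟨le_rfl, le_rfl⟩), mul_one]
  | succ n ih =>
    obtain ⟨f, hf⟩ := ih
    obtain ⟨k', hk'⟩ := hk n
    have hle : t n ≤ t (n + 1) := hm n.le_succ
    -- The old potential is kept up to `t n` and continued over the next small interval by the
    -- values on segments starting at `t n`.
    refine ⟨fun s => if s ≤ t n then f s else val (segmentMap γ (t n) s) * f (t n),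
      fun a b ha hab hb k hk => ?_⟩
    dsimp only
    by_cases hbn : b ≤ t n
    · rw [if_pos hbn, if_pos (hab.trans hbn)]
      exact hf a b ha hab hbn k hk
    rw [if_neg hbn]
    push Not at hbn
    by_cases han : a ≤ t n
    · rw [if_pos han, hf a (t n) ha han le_rfl k fun s hs => hk s ⟨hs.1, hs.2.trans hbn.le⟩,
        ← mul_assoc, ← (hval k).segment_trans γ (convex_Icc a b) hk ⟨le_rfl, hab⟩ ⟨han, hbn.le⟩
          ⟨hab, le_rfl⟩]
    · push Not at han
      rw [if_neg han.not_ge, ← mul_assoc,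
        ← (hval k').segment_trans γ (convex_Icc _ _) hk' ⟨le_rfl, hle⟩ ⟨han.le, hab.trans hb⟩
          ⟨hbn.le, hb⟩]

/-- Potentials along a path differ by a right translation, so the quotient of the two end values
does not depend on the choice. It is the value that the global path homomorphism will take on the
path. -/
theorem IsPathPotential.unique (hU : ∀ k, IsOpen (U k))
    (hcov : ∀ y, ∃ k, y ∈ U k) {γ : C(ℝ, Y)} {f g : ℝ → H} (hf : IsPathPotential val U γ f 1)
    (hg : IsPathPotential val U γ g 1) : f 1 * (f 0)⁻¹ = g 1 * (g 0)⁻¹ := by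
  obtain ⟨t, h0, hm, ht, ⟨N, hN⟩, hk⟩ := exists_subdivision hU hcov γ
  suffices ∀ n, f (t n) * (f 0)⁻¹ = g (t n) * (g 0)⁻¹ from hN ▸ this N
  intro n
  induction n with
  | zero => simp [h0]
  | succ n ih =>
    obtain ⟨k, hk⟩ := hk n
    rw [hf _ _ (ht n).1 (hm n.le_succ) (ht _).2 k hk, hg _ _ (ht n).1 (hm n.le_succ) (ht _).2 k hk,
      mul_assoc, ih, mul_assoc]

/-- The extension of a path to the real line, constant outside the unit interval. -/
def extendLine (γ : C(I, Y)) : C(ℝ, Y) := γ.comp ⟨projIcc 0 1 zero_le_one, continuous_projIcc⟩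

theorem extendLine_of_mem (γ : C(I, Y)) {s : ℝ} (hs : s ∈ I) : extendLine γ s = γ ⟨s, hs⟩ := by
  simp [extendLine, projIcc_of_mem _ hs]

theorem lineMap_mem_Icc {a b : ℝ} (hab : a ≤ b) (t : I) : AffineMap.lineMap a b (t : ℝ) ∈ Icc a b := by
  rw [AffineMap.lineMap_apply]
  constructor <;> simp <;> nlinarith [t.2.1, t.2.2]

theorem IsPathPotential.reparam {γ γ' : C(ℝ, Y)} {f : ℝ → H} (hf : IsPathPotential val U γ f 1)
    (c d : ℝ) (hc : 0 ≤ c) (hd : 0 ≤ d) (hcd : c + d ≤ 1)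
    (h : ∀ s ∈ I, γ' s = γ (c * s + d)) :
    IsPathPotential val U γ' (fun s => f (c * s + d)) 1 := by
  intro a b ha hab hb k hk
  have hseg : segmentMap γ' a b = segmentMap γ (c * a + d) (c * b + d) := by
    ext t
    have := lineMap_mem_Icc hab t
    simp only [segmentMap, ContinuousMap.comp_apply, Path.coe_toContinuousMap]
    rw [Path.segment_apply, Path.segment_apply, h _ ⟨ha.trans this.1, this.2.trans hb⟩]
    congr 1
    simp [AffineMap.lineMap_apply]
    ring
  rw [hseg]
  rcases hc.eq_or_lt with rfl | hc
  · simp only [zero_mul, zero_add] at *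
    exact hf d d hd le_rfl hcd k fun s hs => by
      obtain rfl : s = d := le_antisymm hs.2 hs.1
      rw [← h a ⟨ha, hab.trans hb⟩]
      exact hk a ⟨le_rfl, hab⟩
  refine hf _ _ (by positivity) (by nlinarith) (by nlinarith) k fun s hs => ?_
  have hs' : (s - d) / c ∈ Icc a b := by
    constructor
    · rw [le_div_iff₀ hc]; linarith [hs.1]
    · rw [div_le_iff₀ hc]; linarith [hs.2]
  have := hk _ hs'
  rwa [h _ ⟨ha.trans hs'.1, hs'.2.trans hb⟩, mul_div_cancel₀ _ hc.ne', sub_add_cancel] at this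

/-- The square is cut into cells, each mapped into one member of the cover. Around such a cell the
values cancel, so passing from one row of the grid to the next does not change the total value. -/
theorem Path.Homotopy.pathPotential_eq (hval : ∀ k, IsLocalPathHom val (U k)) (hU : ∀ k, IsOpen (U k))
    (hcov : ∀ y, ∃ k, y ∈ U k) {x y : Y} {p q : Path x y} (F : p.Homotopy q) {f g : ℝ → H}
    (hf : IsPathPotential val U (extendLine p.toContinuousMap) f 1)
    (hg : IsPathPotential val U (extendLine q.toContinuousMap) g 1) :
    f 1 * (f 0)⁻¹ = g 1 * (g 0)⁻¹ := by
  let pr : ℝ → I := projIcc 0 1 zero_le_one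
  have hpr : Continuous pr := continuous_projIcc
  have hpr' : ∀ s : I, pr s = s := fun s => projIcc_val zero_le_one s
  let h : C(ℝ × ℝ, Y) := ⟨fun z => F (pr z.1, pr z.2), by fun_prop⟩
  let c : I → C(ℝ, Y) := fun s => extendLine (F.eval s).toContinuousMap
  obtain ⟨t, h0, hm, ⟨N, hN⟩, hk⟩ := exists_monotone_Icc_subset_open_cover_unitInterval_prod_self
    (c := fun k => {z : I × I | F z ∈ U k}) (fun k => (hU k).preimage F.continuous)
    (fun s _ => by simpa using hcov (F s))
  choose φ hφ using fun s : I => exists_pathPotential hval hU hcov (c s)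
  have hval1 : ∀ z, val (.const I z) = 1 := fun z => by
    obtain ⟨k, hk⟩ := hcov z
    exact (hval k).map_const hk
  have hcseg : ∀ (s a b : I), segmentMap (c s) a b = segmentMap h ((s : ℝ), (a : ℝ)) (s, b) := by
    intro s a b
    ext r
    simp only [segmentMap, ContinuousMap.comp_apply, Path.coe_toContinuousMap]
    rw [Path.segment_apply, Path.segment_apply]
    simp [c, h, extendLine, AffineMap.lineMap_apply, hpr', Path.Homotopy.eval]
    rfl
  -- Induction over the columns: the partial values along two neighbouring rows differ by the value
  -- on the connecting segment. Within a cell both ways around equal the diagonal.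
  have step : ∀ m n, φ (t (m + 1)) (t n) * (φ (t (m + 1)) 0)⁻¹ =
      val (segmentMap h ((t m : ℝ), (t n : ℝ)) (t (m + 1), t n)) *
        (φ (t m) (t n) * (φ (t m) 0)⁻¹) := by
    intro m n
    induction n with
    | zero =>
      have : segmentMap h ((t m : ℝ), (t 0 : ℝ)) (t (m + 1), t 0) = .const I x := by
        ext r
        simp only [segmentMap, ContinuousMap.comp_apply, Path.coe_toContinuousMap]
        rw [Path.segment_apply]
        simp [h, AffineMap.lineMap_apply, h0, pr, projIcc_left]
      rw [this, hval1, h0]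
      simp
    | succ n ih =>
      obtain ⟨k, hk⟩ := hk m n
      have hm0 : (t m : ℝ) ≤ t (m + 1) := hm m.le_succ
      have hn0 : (t n : ℝ) ≤ t (n + 1) := hm n.le_succ
      have hC : ∀ z ∈ Icc (t m : ℝ) (t (m + 1)) ×ˢ Icc (t n : ℝ) (t (n + 1)), h z ∈ U k := by
        rintro ⟨z1, z2⟩ ⟨hz1, hz2⟩
        have e1 : z1 ∈ I := ⟨(t m).2.1.trans hz1.1, hz1.2.trans (t (m + 1)).2.2⟩
        have e2 : z2 ∈ I := ⟨(t n).2.1.trans hz2.1, hz2.2.trans (t (n + 1)).2.2⟩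
        have := hk (a := (⟨z1, e1⟩, ⟨z2, e2⟩)) ⟨hz1, hz2⟩
        simpa [h, pr, projIcc_of_mem _ e1, projIcc_of_mem _ e2] using this
      have hCc : Convex ℝ (Icc (t m : ℝ) (t (m + 1)) ×ˢ Icc (t n : ℝ) (t (n + 1))) :=
        (convex_Icc _ _).prod (convex_Icc _ _)
      have e : ∀ s ∈ Icc (t m) (t (m + 1)), φ s (t (n + 1)) =
          val (segmentMap h ((s : ℝ), (t n : ℝ)) (s, t (n + 1))) * φ s (t n) := by
        intro s hs
        rw [← hcseg]
        refine hφ s _ _ (t n).2.1 hn0 (t (n + 1)).2.2 k fun r hr => ?_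
        have e2 : r ∈ I := ⟨(t n).2.1.trans hr.1, hr.2.trans (t (n + 1)).2.2⟩
        rw [extendLine_of_mem _ e2]
        exact hk (a := (s, ⟨r, e2⟩)) ⟨hs, hr⟩
      rw [e _ ⟨le_rfl, hm0⟩, e _ ⟨hm0, le_rfl⟩, mul_assoc, ih, ← mul_assoc, ← mul_assoc,
        ← mul_assoc, ← mul_assoc,
        ← (hval k).segment_trans h hCc hC (y := ((t (m + 1) : ℝ), (t n : ℝ)))
          ⟨⟨le_rfl, hm0⟩, ⟨le_rfl, hn0⟩⟩ ⟨⟨hm0, le_rfl⟩, ⟨le_rfl, hn0⟩⟩ ⟨⟨hm0, le_rfl⟩, ⟨hn0, le_rfl⟩⟩,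
        ← (hval k).segment_trans h hCc hC (y := ((t m : ℝ), (t (n + 1) : ℝ)))
          ⟨⟨le_rfl, hm0⟩, ⟨le_rfl, hn0⟩⟩ ⟨⟨le_rfl, hm0⟩, ⟨hn0, le_rfl⟩⟩ ⟨⟨hm0, le_rfl⟩, ⟨hn0, le_rfl⟩⟩]
  -- At the right edge the homotopy is constant, so the connecting segment contributes nothing.
  have hconst : ∀ m, φ (t m) 1 * (φ (t m) 0)⁻¹ = φ 0 1 * (φ 0 0)⁻¹ := by
    intro m
    induction m with
    | zero => rw [h0]
    | succ m ih =>
      have := step m N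
      have hs : segmentMap h ((t m : ℝ), (t N : ℝ)) (t (m + 1), t N) = .const I y := by
        ext r
        simp only [segmentMap, ContinuousMap.comp_apply, Path.coe_toContinuousMap]
        rw [Path.segment_apply]
        simp [h, AffineMap.lineMap_apply, hN N le_rfl, pr, projIcc_right]
      rw [hs, hval1, hN N le_rfl, one_mul] at this
      exact this.trans ih
  have hfin := hconst N
  rw [hN N le_rfl] at hfin
  have c0 : c 0 = extendLine p.toContinuousMap := by simp [c]
  have c1 : c 1 = extendLine q.toContinuousMap := by simp [c]
  rw [hf.unique hU hcov (c0 ▸ hφ 0), hg.unique hU hcov (c1 ▸ hφ 1), hfin]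

/-- Local path homomorphisms on the members of an open cover extend to the whole space. -/
theorem exists_pathHom_of_isLocalPathHom (hval : ∀ k, IsLocalPathHom val (U k))
    (hU : ∀ k, IsOpen (U k)) (hcov : ∀ y, ∃ k, y ∈ U k) :
    ∃ Φ : PathHom Y H, ∀ (γ : C(I, Y)) k, range γ ⊆ U k → Φ.toFun γ = val γ := by
  choose f hf using fun γ : C(I, Y) => exists_pathPotential hval hU hcov (extendLine γ)
  refine ⟨⟨fun γ => f γ 1 * (f γ 0)⁻¹, ?_, ?_⟩, ?_⟩
  · intro x y z p q
    have h := hf (p.trans q).toContinuousMap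
    -- A potential along `p.trans q` restricts to potentials along both halves, and uniqueness
    -- identifies their quotients.
    have hp := h.reparam (γ' := extendLine p.toContinuousMap) (1 / 2) 0 (by norm_num) le_rfl
      (by norm_num) (fun s hs => by
        rw [extendLine_of_mem _ hs, extendLine_of_mem _ ⟨by linarith [hs.1], by linarith [hs.2]⟩]
        simp only [Path.coe_toContinuousMap]
        rw [Path.trans_apply, dif_pos (by simp only; linarith [hs.2])]
        congr 1
        ext
        simp)
    have hq := h.reparam (γ' := extendLine q.toContinuousMap) (1 / 2) (1 / 2) (by norm_num)
      (by norm_num) (by norm_num) (fun s hs => by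
        rw [extendLine_of_mem _ hs, extendLine_of_mem _ ⟨by linarith [hs.1], by linarith [hs.2]⟩]
        simp only [Path.coe_toContinuousMap]
        rw [Path.trans_apply]
        split_ifs with hs2
        · have hs0 : s = 0 := by simp only at hs2; linarith [hs.1]
          subst hs0
          have e1 : (⟨0, hs⟩ : I) = 0 := rfl
          rw [e1, q.source]
          symm
          convert! p.target
          norm_num
        · congr 1
          ext
          simp only
          ring)
    rw [(hf p.toContinuousMap).unique hU hcov hp, (hf q.toContinuousMap).unique hU hcov hq]
    norm_num
  · rintro x y p q ⟨F⟩
    exact F.pathPotential_eq hval hU hcov (hf _) (hf _)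
  · intro γ k hk
    dsimp only
    rw [hf γ 0 1 le_rfl zero_le_one le_rfl k fun s hs => by
      rw [extendLine_of_mem _ hs]; exact hk ⟨_, rfl⟩, mul_inv_cancel_right]
    congr 1
    ext r
    simp only [segmentMap, ContinuousMap.comp_apply, Path.coe_toContinuousMap]
    rw [Path.segment_apply]
    simp [extendLine, AffineMap.lineMap_apply]

end Gluing

/-! ### Operations on path homomorphisms -/

namespace PathHom

variable {X Y H : Type*} [TopologicalSpace X] [TopologicalSpace Y] [Group H]

instance : CoeFun (PathHom Y H) fun _ => C(I, Y) → H := ⟨PathHom.toFun⟩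

theorem map_trans (Φ : PathHom Y H) {x y z : Y} (p : Path x y) (q : Path y z) :
    Φ (p.trans q).toContinuousMap = Φ q.toContinuousMap * Φ p.toContinuousMap :=
  Φ.map_trans' p q

theorem map_homotopic (Φ : PathHom Y H) {x y : Y} {p q : Path x y} (h : p.Homotopic q) :
    Φ p.toContinuousMap = Φ q.toContinuousMap :=
  Φ.map_homotopic' h

theorem isLocalPathHom (Φ : PathHom Y H) : IsLocalPathHom Φ (univ : Set Y) :=
  ⟨fun p q _ _ => Φ.map_trans p q, fun F _ => Φ.map_homotopic ⟨F⟩⟩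

@[simp]
theorem map_const (Φ : PathHom Y H) (y : Y) : Φ (.const I y) = 1 :=
  Φ.isLocalPathHom.map_const (mem_univ y)

@[simp]
theorem map_refl (Φ : PathHom Y H) (y : Y) : Φ (Path.refl y).toContinuousMap = 1 :=
  Φ.map_const y

theorem map_symm (Φ : PathHom Y H) {x y : Y} (p : Path x y) :
    Φ p.symm.toContinuousMap = (Φ p.toContinuousMap)⁻¹ := by
  rw [eq_inv_iff_mul_eq_one, ← Φ.map_trans, ← Φ.map_refl x]
  exact Φ.map_homotopic ⟨(Path.Homotopy.reflTransSymm p).symm⟩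

theorem segment_trans {E : Type*} [AddCommGroup E] [Module ℝ E] [TopologicalSpace E]
    [IsTopologicalAddGroup E] [ContinuousSMul ℝ E] (Φ : PathHom Y H) (h : C(E, Y)) (x y z : E) :
    Φ (segmentMap h x z) = Φ (segmentMap h y z) * Φ (segmentMap h x y) :=
  Φ.isLocalPathHom.segment_trans h convex_univ (fun _ _ => mem_univ _) (mem_univ x) (mem_univ y)
    (mem_univ z)

/-- The two ways around a square agree. -/
theorem map_square (Φ : PathHom Y H) (h : C(I × I, Y)) :
    Φ (h.comp ((ContinuousMap.const I 1).prodMk (.id I))) *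
      Φ (h.comp ((ContinuousMap.id I).prodMk (.const I 0))) =
    Φ (h.comp ((ContinuousMap.id I).prodMk (.const I 1))) *
      Φ (h.comp ((ContinuousMap.const I 0).prodMk (.id I))) := by
  -- The square is extended to the plane by clamping, so that both ways around can be compared with
  -- the diagonal segment.
  let pr : C(ℝ, I) := ⟨projIcc 0 1 zero_le_one, continuous_projIcc⟩
  let h' : C(ℝ × ℝ, Y) := h.comp (pr.prodMap pr)
  have h1 := Φ.segment_trans h' (0, 0) (1, 0) (1, 1)
  have h2 := Φ.segment_trans h' (0, 0) (0, 1) (1, 1)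
  have hs : ∀ x y, Φ (segmentMap h' x y) = Φ (h'.comp (Path.segment x y).toContinuousMap) :=
    fun _ _ => rfl
  rw [h1] at h2
  convert! h2 using 3 <;>
  · ext r
    simp only [segmentMap, ContinuousMap.comp_apply, Path.coe_toContinuousMap]
    rw [Path.segment_apply]
    simp [h', pr, AffineMap.lineMap_apply]

/-- The pull-back along a continuous map. -/
def comap (Φ : PathHom Y H) (f : C(X, Y)) : PathHom X H where
  toFun γ := Φ (f.comp γ)
  map_trans' p q := by
    have := Φ.map_trans (p.map f.continuous) (q.map f.continuous)
    rwa [← Path.map_trans] at this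
  map_homotopic' h := Φ.map_homotopic' (h.map f)

@[simp]
theorem comap_apply (Φ : PathHom Y H) (f : C(X, Y)) (γ : C(I, X)) :
    Φ.comap f γ = Φ (f.comp γ) := rfl

/-- The composition with a group homomorphism. -/
def comp {H' : Type*} [Group H'] (f : H →* H') (Φ : PathHom Y H) : PathHom Y H' where
  toFun γ := f (Φ γ)
  map_trans' p q := by rw [Φ.map_trans, map_mul]
  map_homotopic' h := by rw [Φ.map_homotopic h]

@[simp]
theorem comp_apply {H' : Type*} [Group H'] (f : H →* H') (Φ : PathHom Y H) (γ : C(I, Y)) :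
    Φ.comp f γ = f (Φ γ) := rfl

/-- The conjugate of `Φ` by a function on `Y`. -/
def gauge (Φ : PathHom Y H) (g : Y → H) : PathHom Y H where
  toFun γ := g (γ 1) * Φ γ * (g (γ 0))⁻¹
  map_trans' p q := by
    rw [Φ.map_trans]
    simp [mul_assoc]
  map_homotopic' {x y p q} h := by
    rw [Φ.map_homotopic h]
    simp

@[simp]
theorem gauge_apply (Φ : PathHom Y H) (g : Y → H) (γ : C(I, Y)) :
    Φ.gauge g γ = g (γ 1) * Φ γ * (g (γ 0))⁻¹ := rfl

end PathHom

/-! ### Van Kampen's theorem for two open subspaces -/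

theorem Topology.IsEmbedding.exists_comp_eq {T A Y : Type*} [TopologicalSpace T]
    [TopologicalSpace A] [TopologicalSpace Y] {j : C(A, Y)} (hj : IsEmbedding j) (f : C(T, Y))
    (hf : range f ⊆ range j) : ∃ α : C(T, A), j.comp α = f := by
  choose α hα using fun t => hf ⟨t, rfl⟩
  refine ⟨⟨α, ?_⟩, by ext t; exact hα t⟩
  rw [hj.continuous_iff]
  convert! f.continuous using 1
  ext t
  exact hα t

/-- Paths and homotopies inside the image of an embedding lift continuously; injectivity keeps the
end points of the lifts fixed. -/
theorem IsLocalPathHom.of_isEmbedding {A Y H : Type*} [TopologicalSpace A] [TopologicalSpace Y]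
    [Group H] {j : C(A, Y)} (hj : IsEmbedding j) (χ : PathHom A H) {val : C(I, Y) → H}
    (hval : ∀ α, val (j.comp α) = χ α) : IsLocalPathHom val (range j) := by
  constructor
  · intro x y z p q hp hq
    obtain ⟨α, hα⟩ := hj.exists_comp_eq p.toContinuousMap hp
    obtain ⟨β, hβ⟩ := hj.exists_comp_eq q.toContinuousMap hq
    have h1 : β 0 = α 1 := hj.injective <| by
      have h1 := DFunLike.congr_fun hα 1
      have h2 := DFunLike.congr_fun hβ 0
      simp only [ContinuousMap.comp_apply, Path.coe_toContinuousMap, Path.source,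
        Path.target] at h1 h2
      rw [h1, h2]
    let P : Path (α 0) (α 1) := ⟨α, rfl, rfl⟩
    let Q : Path (α 1) (β 1) := ⟨β, h1, rfl⟩
    have h2 : (p.trans q).toContinuousMap = j.comp (P.trans Q).toContinuousMap := by
      ext s
      simp only [ContinuousMap.comp_apply, Path.coe_toContinuousMap, Path.trans_apply]
      split_ifs
      · exact (DFunLike.congr_fun hα _).symm
      · exact (DFunLike.congr_fun hβ _).symm
    rw [h2, ← hα, ← hβ, hval, hval, hval]
    exact χ.map_trans P Q
  · intro x y p q F hF
    obtain ⟨G, hG⟩ := hj.exists_comp_eq F.toContinuousMap hF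
    have hG' : ∀ z, j (G z) = F z := DFunLike.congr_fun hG
    let P : Path (G (0, 0)) (G (0, 1)) :=
      ⟨G.comp ((ContinuousMap.const I 0).prodMk (.id I)), rfl, rfl⟩
    let Q : Path (G (0, 0)) (G (0, 1)) :=
      ⟨G.comp ((ContinuousMap.const I 1).prodMk (.id I)), hj.injective (by
        change j (G (1, 0)) = j (G (0, 0))
        rw [hG', hG', F.source, F.source]), hj.injective (by
        change j (G (1, 1)) = j (G (0, 1))
        rw [hG', hG', F.target, F.target])⟩
    have hPQ : P.Homotopic Q := ⟨{
      toContinuousMap := G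
      map_zero_left := fun _ => rfl
      map_one_left := fun _ => rfl
      prop' := by
        rintro t s (rfl | hs)
        · refine hj.injective ?_
          change j (G (t, 0)) = j (G (0, 0))
          rw [hG', hG', F.source, F.source]
        · obtain rfl : s = 1 := hs
          refine hj.injective ?_
          change j (G (t, 1)) = j (G (0, 1))
          rw [hG', hG', F.target, F.target] }⟩
    have hP : p.toContinuousMap = j.comp P.toContinuousMap := by
      ext s
      exact ((hG' (0, s)).trans (F.map_zero_left s)).symm
    have hQ : q.toContinuousMap = j.comp Q.toContinuousMap := by
      ext s
      exact ((hG' (1, s)).trans (F.map_one_left s)).symm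
    rw [hP, hQ, hval, hval]
    exact χ.map_homotopic hPQ

/-- The universal property in van Kampen's theorem, for a union of two open subspaces. -/
theorem exists_pathHom_of_isOpenEmbedding {A B Y H : Type*} [TopologicalSpace A]
    [TopologicalSpace B] [TopologicalSpace Y] [Group H] {j : C(A, Y)} {k : C(B, Y)}
    (hj : IsOpenEmbedding j) (hk : IsOpenEmbedding k) (hcov : ∀ y, y ∈ range j ∨ y ∈ range k)
    (χ : PathHom A H) (ξ : PathHom B H) (h : ∀ α β, j.comp α = k.comp β → χ α = ξ β) :
    ∃ Φ : PathHom Y H, ∀ α, Φ (j.comp α) = χ α := by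
  classical
  let val : C(I, Y) → H := fun γ =>
    if h : ∃ α, j.comp α = γ then χ h.choose else
    if h : ∃ β, k.comp β = γ then ξ h.choose else 1
  have hA : ∀ α, val (j.comp α) = χ α := fun α => by
    have h : ∃ α', j.comp α' = j.comp α := ⟨α, rfl⟩
    simp only [val, dif_pos h]
    exact congrArg χ ((ContinuousMap.cancel_left hj.injective).mp h.choose_spec)
  have hB : ∀ β, val (k.comp β) = ξ β := fun β => by
    by_cases h1 : ∃ α, j.comp α = k.comp β
    · obtain ⟨α, hα⟩ := h1
      rw [← hα, hA]
      exact h α β hα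
    · have h2 : ∃ β', k.comp β' = k.comp β := ⟨β, rfl⟩
      simp only [val, dif_neg h1, dif_pos h2]
      exact congrArg ξ ((ContinuousMap.cancel_left hk.injective).mp h2.choose_spec)
  obtain ⟨Φ, hΦ⟩ := exists_pathHom_of_isLocalPathHom (val := val)
    (U := fun b : Bool => if b then range j else range k)
    (by
      rintro (_ | _)
      · exact .of_isEmbedding hk.isEmbedding ξ hB
      · exact .of_isEmbedding hj.isEmbedding χ hA)
    (by
      rintro (_ | _)
      · exact hk.isOpen_range
      · exact hj.isOpen_range)
    (by
      intro y
      rcases hcov y with h | h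
      · exact ⟨true, h⟩
      · exact ⟨false, h⟩)
  refine ⟨Φ, fun α => ?_⟩
  rw [hΦ _ true (by rintro _ ⟨s, rfl⟩; exact ⟨α s, rfl⟩), hA]

/-! ### Fillings, and extension of path homomorphisms over them -/

/-- The loop `s ↦ exp (2 π i s)`. -/
def circleLoop : C(I, Circle) := ⟨fun s => Circle.exp (2 * Real.pi * s), by fun_prop⟩

/-- The non-zero complex numbers. -/
abbrev PuncturedPlane : Type := {z : ℂ // z ≠ 0}

/-- The inclusion of the unit circle. -/
def Circle.toPuncturedPlane : C(Circle, PuncturedPlane) :=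
  ⟨fun s => ⟨s, s.coe_ne_zero⟩, by fun_prop⟩

/-- The space `Y` is the union of its open subspaces `A` and `P × ℂ`, which meet in
`P × (ℂ ∖ 0)`. -/
structure IsFilling {A P Y : Type*} [TopologicalSpace A] [TopologicalSpace P] [TopologicalSpace Y]
    (j : C(A, Y)) (k : C(P × ℂ, Y)) (e : C(P × PuncturedPlane, A)) : Prop where
  left : IsOpenEmbedding j
  right : IsOpenEmbedding k
  cover : ∀ y, y ∈ range j ∨ y ∈ range k
  comm : ∀ t z, j (e (t, z)) = k (t, (z : ℂ))
  core : ∀ t, k (t, 0) ∉ range j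

namespace IsFilling

variable {A P Y H : Type*} [TopologicalSpace A] [TopologicalSpace P] [TopologicalSpace Y] [Group H]
  {j : C(A, Y)} {k : C(P × ℂ, Y)} {e : C(P × PuncturedPlane, A)}

/-- The universal cover `w ↦ e (t, exp w)` of a punctured fibre. -/
def fibreExp (e : C(P × PuncturedPlane, A)) (t : P) : C(ℂ, A) :=
  ⟨fun w => e (t, ⟨Complex.exp w, Complex.exp_ne_zero w⟩), by fun_prop⟩

/-- The boundary circle of a fibre. -/
def fibreCircle (e : C(P × PuncturedPlane, A)) (t : P) : C(Circle, A) :=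
  e.comp ((ContinuousMap.const _ t).prodMk Circle.toPuncturedPlane)

theorem segmentMap_fibreExp (e : C(P × PuncturedPlane, A)) (t : P) :
    segmentMap (fibreExp e t) 0 (2 * Real.pi * Complex.I) = (fibreCircle e t).comp circleLoop := by
  ext s
  simp only [segmentMap, ContinuousMap.comp_apply, Path.coe_toContinuousMap]
  rw [Path.segment_apply]
  simp only [fibreExp, fibreCircle, Circle.toPuncturedPlane, circleLoop, ContinuousMap.coe_mk,
    ContinuousMap.comp_apply, ContinuousMap.prod_eval, ContinuousMap.const_apply]
  congr 3
  rw [Circle.coe_exp]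
  congr 1
  simp [AffineMap.lineMap_apply]
  ring

/-- The value along `0 ⟶ w` has period `2πi` in `w` because the boundary circle has value `1`. Hence
it descends from the universal cover to the punctured fibre. -/
theorem segmentMap_fibreExp_eq (χ : PathHom A H) {t : P}
    (hχ : χ ((fibreCircle e t).comp circleLoop) = 1) {w w' : ℂ} (h : Complex.exp w = Complex.exp w') :
    χ (segmentMap (fibreExp e t) 0 w) = χ (segmentMap (fibreExp e t) 0 w') := by
  have hper : Function.Periodic (fun w => χ (segmentMap (fibreExp e t) 0 w))
      (2 * Real.pi * Complex.I) := by
    intro w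
    have hshift : segmentMap (fibreExp e t) (2 * Real.pi * Complex.I)
        (w + 2 * Real.pi * Complex.I) = segmentMap (fibreExp e t) 0 w := by
      ext s
      simp only [segmentMap, ContinuousMap.comp_apply, Path.coe_toContinuousMap]
      rw [Path.segment_apply, Path.segment_apply]
      simp only [fibreExp, ContinuousMap.coe_mk]
      congr 3
      refine Eq.trans ?_ (Complex.exp_periodic _)
      congr 1
      simp [AffineMap.lineMap_apply]
    simp only
    rw [χ.segment_trans _ _ (2 * Real.pi * Complex.I), hshift, segmentMap_fibreExp, hχ, mul_one]
  obtain ⟨n, hn⟩ := Complex.exp_eq_exp_iff_exists_int.mp h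
  rw [hn]
  exact hper.int_mul n w'

theorem e_injective (h : IsFilling j k e) : Function.Injective e := by
  rintro ⟨t, z⟩ ⟨t', z'⟩ heq
  have := h.right.injective ((h.comm t z).symm.trans ((congrArg j heq).trans (h.comm t' z')))
  simp only [Prod.mk.injEq] at this
  exact Prod.ext this.1 (Subtype.ext this.2)

theorem ne_zero (h : IsFilling j k e) {t : P} {z : ℂ} (hz : k (t, z) ∈ range j) : z ≠ 0 := by
  rintro rfl
  exact h.core t hz

/-- A path homomorphism on `A` which is trivial on the boundary circles of the fibres extends to
the filling, up to conjugation. -/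
theorem exists_pathHom (h : IsFilling j k e) (χ : PathHom A H)
    (hχ : ∀ t, χ ((fibreCircle e t).comp circleLoop) = 1) :
    ∃ (Φ : PathHom Y H) (g : A → H), ∀ α, Φ (j.comp α) = χ.gauge g α := by
  classical
  let a : P → ℂ → H := fun t w => χ (segmentMap (fibreExp e t) 0 w)
  -- The conjugating function is the inverse of the value along a path in the fibre from `e (t, 1)`
  -- to `e (t, z)`; off the image of `e` it is `1`.
  let g : A → H := fun x => if hx : ∃ y, e y = x then
    (a hx.choose.1 (Complex.log hx.choose.2))⁻¹ else 1
  have hg : ∀ t z w, Complex.exp w = z.1 → g (e (t, z)) = (a t w)⁻¹ := by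
    intro t z w hw
    have hx : ∃ y, e y = e (t, z) := ⟨_, rfl⟩
    have hx' := h.e_injective hx.choose_spec
    simp only [g, dif_pos hx]
    rw [hx']
    congr 1
    refine segmentMap_fibreExp_eq χ (hχ t) ?_
    rw [Complex.exp_log z.2, hw]
  -- On `P × ℂ` only the coordinate in `P` matters up to homotopy. It is read off from the section
  -- `z = 1`, since the zero section does not lie in `A`.
  let ξ : PathHom (P × ℂ) H :=
    χ.comap (e.comp (ContinuousMap.fst.prodMk (.const _ ⟨1, one_ne_zero⟩)))
  suffices hagree : ∀ α β, j.comp α = k.comp β → χ.gauge g α = ξ β by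
    obtain ⟨Φ, hΦ⟩ := exists_pathHom_of_isOpenEmbedding h.left h.right h.cover _ _ hagree
    exact ⟨Φ, g, hΦ⟩
  intro α β hαβ
  have hαβ' : ∀ s, j (α s) = k (β s) := DFunLike.congr_fun hαβ
  have hz : ∀ s, (β s).2 ≠ 0 := fun s => h.ne_zero (t := (β s).1) ⟨α s, hαβ' s⟩
  let z : C(I, PuncturedPlane) := ⟨fun s => ⟨(β s).2, hz s⟩, by fun_prop⟩
  -- A logarithm `w` of the fibre coordinate is lifted along the path. In the square `sq` below, one
  -- pair of opposite sides is `α` and its projection to the section `z = 1`, and the other pair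
  -- consists of the fibre paths recorded by `g`.
  obtain ⟨w, hw, -⟩ := Complex.isCoveringMap_exp.exists_path_lifts z (Complex.log (z 0))
    (Subtype.ext (Complex.exp_log (z 0).2).symm)
  have hw' : ∀ s, Complex.exp (w s) = (β s).2 := fun s => congrArg Subtype.val (congrFun hw s)
  have hα : ∀ s, α s = e ((β s).1, z s) := fun s => h.left.injective <| by
    rw [hαβ', h.comm]
    rfl
  let sq : C(I × I, A) := ⟨fun x => e ((β x.1).1, ⟨Complex.exp (x.2 * w x.1),
    Complex.exp_ne_zero _⟩), by fun_prop⟩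
  have key := χ.map_square sq
  have e1 : ∀ s : I, sq.comp ((ContinuousMap.const I s).prodMk (.id I)) =
      segmentMap (fibreExp e (β s).1) 0 (w s) := by
    intro s
    ext r
    simp only [segmentMap, ContinuousMap.comp_apply, Path.coe_toContinuousMap]
    rw [Path.segment_apply]
    simp [sq, fibreExp, AffineMap.lineMap_apply]
  have e2 : sq.comp ((ContinuousMap.id I).prodMk (.const I 1)) = α := by
    ext s
    simp [sq, hα, z, hw']
  have e3 : χ (sq.comp ((ContinuousMap.id I).prodMk (.const I 0))) = ξ β := by
    simp only [ξ, PathHom.comap_apply]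
    congr 1
    ext s
    simp [sq]
  rw [e1, e1, e2, e3] at key
  rw [PathHom.gauge_apply, hα 0, hα 1, hg _ _ _ (hw' 1), hg _ _ _ (hw' 0), inv_inv, mul_assoc,
    ← key, inv_mul_cancel_left]

end IsFilling

/-! ### Pushing paths of a filling off the cores -/

/-- Induction along a path: a property of paths which is stable under composition and homotopy
and holds for the paths contained in a member of an open cover holds for all paths. -/
theorem Path.induction_of_cover {Y κ : Type*} [TopologicalSpace Y] {U : κ → Set Y}
    (hU : ∀ k, IsOpen (U k)) (hcov : ∀ y, ∃ k, y ∈ U k) (Q : ∀ {x y : Y}, Path x y → Prop)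
    (small : ∀ {x y : Y} (p : Path x y) k, range p ⊆ U k → Q p)
    (trans : ∀ {x y z : Y} (p : Path x y) (q : Path y z), Q p → Q q → Q (p.trans q))
    (homotopic : ∀ {x y : Y} {p q : Path x y}, p.Homotopic q → Q p → Q q)
    {x y : Y} (p : Path x y) : Q p := by
  have hcast : ∀ {x y x' y' : Y} (p : Path x y) (hx : x' = x) (hy : y' = y), Q (p.cast hx hy) →
      Q p := by
    rintro x y x' y' p rfl rfl h
    exact h
  let γ := extendLine p.toContinuousMap
  obtain ⟨t, h0, hm, ht, ⟨N, hN⟩, hk⟩ := exists_subdivision hU hcov γ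
  have key : ∀ n, Q ((Path.segment 0 (t n)).map γ.continuous) := by
    intro n
    induction n with
    | zero =>
      obtain ⟨k, hk⟩ := hk 0
      refine small _ k ?_
      rintro _ ⟨s, rfl⟩
      have : (Path.segment 0 (t 0)) s = t 0 := by rw [h0, Path.segment_same]; rfl
      rw [Path.map_coe, Function.comp_apply, this]
      exact hk _ ⟨le_rfl, hm (Nat.le_succ 0)⟩
    | succ n ih =>
      obtain ⟨k, hk⟩ := hk n
      have hs : Q ((Path.segment (t n) (t (n + 1))).map γ.continuous) := by
        refine small _ k ?_
        rintro _ ⟨s, rfl⟩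
        rw [Path.map_coe, Function.comp_apply, Path.segment_apply]
        exact hk _ (lineMap_mem_Icc (hm n.le_succ) s)
      have h2 := trans _ _ ih hs
      rw [← Path.map_trans] at h2
      exact homotopic (Path.Homotopic.map ⟨Path.Homotopy.ofAffine _ _⟩ γ) h2
  have hend : ∀ s : I, γ s = p s := fun s => by
    simp only [γ]
    rw [extendLine_of_mem _ s.2]
    rfl
  have e0 : γ 0 = x := (hend 0).trans p.source
  have e1 : γ (t N) = y := by rw [hN]; exact (hend 1).trans p.target
  refine hcast p e0 e1 ?_
  convert! key N
  ext s
  rw [Path.map_coe, Function.comp_apply, Path.segment_apply]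
  simp [AffineMap.lineMap_apply, hend, hN]

theorem Path.homotopic_of_map_fst_of_map_snd {X Y : Type*} [TopologicalSpace X]
    [TopologicalSpace Y] {x y : X × Y} {p q : Path x y}
    (h1 : (p.map continuous_fst).Homotopic (q.map continuous_fst))
    (h2 : (p.map continuous_snd).Homotopic (q.map continuous_snd)) : p.Homotopic q := by
  obtain ⟨F⟩ := h1
  obtain ⟨G⟩ := h2
  exact ⟨Path.Homotopic.prodHomotopy F G⟩

instance : PathConnectedSpace PuncturedPlane := by
  have : IsPathConnected {z : ℂ | z ≠ 0} := by
    have := isPathConnected_compl_singleton_of_one_lt_rank (E := ℂ) (by simp) 0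
    exact this
  exact isPathConnected_iff_pathConnectedSpace.mp this

namespace IsFilling

open Path.Homotopic.Quotient renaming mk → pathClass

variable {A P Y : Type*} [TopologicalSpace A] [TopologicalSpace P] [TopologicalSpace Y]
  {j : C(A, Y)} {k : C(P × ℂ, Y)} {e : C(P × PuncturedPlane, A)}

/-- A path from `y` to a point of `A` which stays in `A` or in `P × ℂ`. -/
structure PushOff (j : C(A, Y)) (k : C(P × ℂ, Y)) (e : C(P × PuncturedPlane, A)) (y : Y) where
  /-- The end point. -/
  pt : A
  /-- The path. -/
  path : Path y (j pt)
  -- The path must be homotopic to one inside each piece that contains `y`. In the overlap both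
  -- conditions apply, so the same push-off serves small paths of either kind.
  left : ∀ b (hb : j b = y), ∃ δ : Path b pt, pathClass path = pathClass ((δ.map j.continuous).cast hb.symm rfl)
  right : ∀ u (hu : k u = y), ∃ (u' : P × PuncturedPlane) (ε : Path u (u'.1, (u'.2 : ℂ)))
    (h : j pt = k (u'.1, (u'.2 : ℂ))), pathClass path = pathClass ((ε.map k.continuous).cast hu.symm h)

/-- A point of `A` stays where it is. A remaining point lies on a core and moves inside its fibre to
the point with coordinate `1`. -/
theorem nonempty_pushOff (h : IsFilling j k e) (y : Y) : Nonempty (PushOff j k e y) := by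
  by_cases hy : y ∈ range j
  · obtain ⟨b, rfl⟩ := hy
    refine ⟨⟨b, Path.refl _, fun b' hb => ?_, fun u hu => ?_⟩⟩
    · obtain rfl := h.left.injective hb
      exact ⟨Path.refl _, rfl⟩
    · exact ⟨(u.1, ⟨u.2, h.ne_zero (t := u.1) ⟨b, hu.symm⟩⟩), Path.refl u, hu.symm, by
        congr 1; ext s; simp [hu]⟩
  · obtain ⟨u, rfl⟩ := (h.cover y).resolve_left hy
    refine ⟨⟨e (u.1, ⟨1, one_ne_zero⟩), (((Path.refl u.1).prod (Path.segment u.2 1)).map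
      k.continuous).cast rfl (h.comm _ _), fun b hb => (hy ⟨b, hb⟩).elim, fun u' hu => ?_⟩⟩
    obtain rfl := h.right.injective hu
    exact ⟨(u'.1, ⟨1, one_ne_zero⟩), (Path.refl u'.1).prod (Path.segment u'.2 1), h.comm _ _, rfl⟩

/-- Every path in the filling can be pushed into `A`. -/
theorem exists_path (h : IsFilling j k e) (c : ∀ y, PushOff j k e y) {x y : Y} (p : Path x y) :
    ∃ α : Path (c x).pt (c y).pt, (pathClass p).trans (pathClass (c y).path) =
      (pathClass (c x).path).trans (pathClass (α.map j.continuous)) := by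
  refine Path.induction_of_cover (U := fun b : Bool => if b then range j else range k)
    ?_ ?_ (fun {x y} p => ∃ α : Path (c x).pt (c y).pt, (pathClass p).trans (pathClass (c y).path) =
      (pathClass (c x).path).trans (pathClass (α.map j.continuous))) ?_ ?_ ?_ p
  · rintro (_ | _)
    · exact h.right.isOpen_range
    · exact h.left.isOpen_range
  · intro y
    rcases h.cover y with h | h
    · exact ⟨true, h⟩
    · exact ⟨false, h⟩
  · rintro x y p (_ | _) hp
    · obtain ⟨β, hβ⟩ := h.right.isEmbedding.exists_comp_eq p.toContinuousMap hp
      have hβ' : ∀ s, k (β s) = p s := DFunLike.congr_fun hβ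
      obtain rfl : k (β 0) = x := (hβ' 0).trans p.source
      obtain rfl : k (β 1) = y := (hβ' 1).trans p.target
      let B : Path (β 0) (β 1) := ⟨β, rfl, rfl⟩
      obtain rfl : p = B.map k.continuous := by ext s; exact (hβ' s).symm
      obtain ⟨u, ε, hu, hε⟩ := (c _).right _ (rfl : k (β 0) = _)
      obtain ⟨v, ε', hv, hε'⟩ := (c _).right _ (rfl : k (β 1) = _)
      -- The coordinate in `P` is forced up to homotopy. The fibre coordinate may be any path in the
      -- connected punctured plane, since all choices become homotopic in the simply connected `ℂ`.
      let ζ₁ : Path u.1 v.1 := (ε.map continuous_fst).symm.trans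
        ((B.map continuous_fst).trans (ε'.map continuous_fst))
      let ζ₂ : Path u.2 v.2 := PathConnectedSpace.somePath u.2 v.2
      let ζ : Path u v := ζ₁.prod ζ₂
      have hu' : (c (k (β 0))).pt = e u := h.left.injective (hu.trans (h.comm _ _).symm)
      have hv' : (c (k (β 1))).pt = e v := h.left.injective (hv.trans (h.comm _ _).symm)
      have key : (B.trans ε').Homotopic (ε.trans (ζ₁.prod (ζ₂.map continuous_subtype_val))) := by
        refine Path.homotopic_of_map_fst_of_map_snd ?_ (SimplyConnectedSpace.paths_homotopic _ _)
        rw [Path.map_trans, Path.map_trans]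
        have : (ζ₁.prod (ζ₂.map continuous_subtype_val)).map continuous_fst = ζ₁ := rfl
        rw [this, ← Path.Homotopic.Quotient.eq]
        simp only [ζ₁, Path.Homotopic.Quotient.mk_trans, Path.Homotopic.Quotient.mk_symm]
        rw [← Path.Homotopic.Quotient.trans_assoc, Path.Homotopic.Quotient.trans_symm,
          Path.Homotopic.Quotient.refl_trans]
      refine ⟨(ζ.map e.continuous).cast hu' hv', ?_⟩
      rw [hε, hε', ← Path.Homotopic.Quotient.mk_trans, ← Path.Homotopic.Quotient.mk_trans,
        Path.Homotopic.Quotient.eq]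
      have key' := (key.map k).pathCast rfl hv
      rw [Path.map_trans, Path.map_trans] at key'
      convert! key' using 1
      ext s
      simp only [Path.cast_coe, Path.trans_apply]
      split_ifs with hs
      · rfl
      · exact h.comm _ _
    · obtain ⟨α, hα⟩ := h.left.isEmbedding.exists_comp_eq p.toContinuousMap hp
      have hα' : ∀ s, j (α s) = p s := DFunLike.congr_fun hα
      obtain rfl : j (α 0) = x := (hα' 0).trans p.source
      obtain rfl : j (α 1) = y := (hα' 1).trans p.target
      let B : Path (α 0) (α 1) := ⟨α, rfl, rfl⟩
      obtain rfl : p = B.map j.continuous := by ext s; exact (hα' s).symm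
      obtain ⟨δ, hδ⟩ := (c _).left _ (rfl : j (α 0) = _)
      obtain ⟨δ', hδ'⟩ := (c _).left _ (rfl : j (α 1) = _)
      refine ⟨δ.symm.trans (B.trans δ'), ?_⟩
      rw [hδ, hδ']
      simp only [Path.cast_rfl_rfl, Path.map_trans, Path.Homotopic.Quotient.mk_trans]
      rw [← Path.Homotopic.Quotient.trans_assoc, ← Path.map_symm, Path.Homotopic.Quotient.mk_symm,
        Path.Homotopic.Quotient.trans_symm, Path.Homotopic.Quotient.refl_trans]
  · rintro x y z p q ⟨α, hα⟩ ⟨β, hβ⟩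
    refine ⟨α.trans β, ?_⟩
    rw [Path.map_trans, Path.Homotopic.Quotient.mk_trans, Path.Homotopic.Quotient.mk_trans,
      Path.Homotopic.Quotient.trans_assoc, hβ, ← Path.Homotopic.Quotient.trans_assoc, hα,
      Path.Homotopic.Quotient.trans_assoc]
  · rintro x y p q hpq ⟨α, hα⟩
    exact ⟨α, by rw [← Path.Homotopic.Quotient.eq.mpr hpq, hα]⟩

/-- A path in `Y` between two points of `A` is pushed into `A`, and the push-offs of its end points
are themselves paths in `A`. -/
theorem pathConnectedSpace_left (h : IsFilling j k e) [PathConnectedSpace Y] [Nonempty A] :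
    PathConnectedSpace A := by
  refine ⟨inferInstance, fun a b => ?_⟩
  let c := fun y => (h.nonempty_pushOff y).some
  obtain ⟨α, -⟩ := h.exists_path c (PathConnectedSpace.somePath (j a) (j b))
  obtain ⟨δ, -⟩ := (c (j a)).left a rfl
  obtain ⟨δ', -⟩ := (c (j b)).left b rfl
  exact ⟨δ.trans (α.trans δ'.symm)⟩

theorem pathConnectedSpace (h : IsFilling j k e) [PathConnectedSpace A] :
    PathConnectedSpace Y := by
  refine ⟨⟨j (PathConnectedSpace.nonempty (X := A)).some⟩,
    fun x y => ?_⟩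
  obtain ⟨c⟩ := h.nonempty_pushOff x
  obtain ⟨d⟩ := h.nonempty_pushOff y
  exact ⟨c.path.trans (((PathConnectedSpace.somePath c.pt d.pt).map j.continuous).trans
    d.path.symm)⟩

/-- The fundamental group of `A` surjects onto that of the filling. -/
theorem exists_path_map_homotopic (h : IsFilling j k e) {a b : A} (p : Path (j a) (j b)) :
    ∃ α : Path a b, p.Homotopic (α.map j.continuous) := by
  let c := fun y => (h.nonempty_pushOff y).some
  obtain ⟨α, hα⟩ := h.exists_path c p
  obtain ⟨δ, hδ⟩ := (c (j a)).left a rfl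
  obtain ⟨δ', hδ'⟩ := (c (j b)).left b rfl
  refine ⟨δ.trans (α.trans δ'.symm), ?_⟩
  rw [hδ, hδ'] at hα
  simp only [Path.cast_rfl_rfl] at hα
  rw [← Path.Homotopic.Quotient.eq]
  simp only [Path.map_trans, ← Path.map_symm, Path.Homotopic.Quotient.mk_trans,
    Path.Homotopic.Quotient.mk_symm]
  rw [← Path.Homotopic.Quotient.trans_assoc, ← hα, Path.Homotopic.Quotient.trans_assoc,
    Path.Homotopic.Quotient.trans_symm, Path.Homotopic.Quotient.trans_refl]

end IsFilling

/-! ### Closed curves and fundamental groups -/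

/-- The path running once around a closed curve. -/
def loopPath {Y : Type*} [TopologicalSpace Y] (c : C(Circle, Y)) : Path (c 1) (c 1) where
  toContinuousMap := c.comp circleLoop
  source' := by simp [circleLoop]
  target' := by simp [circleLoop]

namespace PathHom

variable {X Y H : Type*} [TopologicalSpace X] [TopologicalSpace Y] [Group H]

/-- The value of `Φ` on a closed curve. -/
def loop (Φ : PathHom Y H) (c : C(Circle, Y)) : H := Φ (c.comp circleLoop)

theorem apply_loopPath (Φ : PathHom Y H) (c : C(Circle, Y)) :
    Φ (loopPath c).toContinuousMap = Φ.loop c := rfl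

theorem loop_comap (Φ : PathHom Y H) (f : C(X, Y)) (c : C(Circle, X)) :
    (Φ.comap f).loop c = Φ.loop (f.comp c) := rfl

/-- The homomorphism on the fundamental group. -/
def toMonoidHom (Φ : PathHom Y H) (x : Y) : FundamentalGroup Y x →* H where
  toFun p := Quotient.lift (s := Path.Homotopic.setoid x x)
    (fun q : Path x x => Φ q.toContinuousMap) (fun _ _ h => Φ.map_homotopic h) p
  map_one' := Φ.map_refl x
  map_mul' p q := by
    induction p using Path.Homotopic.Quotient.ind
    induction q using Path.Homotopic.Quotient.ind
    exact Φ.map_trans _ _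

@[simp]
theorem toMonoidHom_mk (Φ : PathHom Y H) {x : Y} (p : Path x x) :
    Φ.toMonoidHom x (Path.Homotopic.Quotient.mk p) = Φ p.toContinuousMap := rfl

/-- A path homomorphism is faithful if it is injective on all fundamental groups. -/
def IsFaithful (Φ : PathHom Y H) : Prop :=
  ∀ {x : Y} (p : Path x x), Φ p.toContinuousMap = 1 → p.Homotopic (Path.refl x)

theorem IsFaithful.homotopic {Φ : PathHom Y H} (hΦ : Φ.IsFaithful) {x y : Y} {p q : Path x y}
    (h : Φ p.toContinuousMap = Φ q.toContinuousMap) : p.Homotopic q := by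
  have h1 : (p.trans q.symm).Homotopic (Path.refl x) :=
    hΦ _ (by rw [Φ.map_trans, Φ.map_symm, h, inv_mul_cancel])
  have h2 := h1.hcomp (Path.Homotopic.refl q)
  rw [← Path.Homotopic.Quotient.eq] at h2 ⊢
  simpa [Path.Homotopic.Quotient.mk_trans, Path.Homotopic.Quotient.mk_symm,
    Path.Homotopic.Quotient.trans_assoc] using h2

theorem IsFaithful.toMonoidHom_injective {Φ : PathHom Y H} (hΦ : Φ.IsFaithful) (x : Y) :
    Function.Injective (Φ.toMonoidHom x) := by
  intro p q h
  induction p using Path.Homotopic.Quotient.ind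
  induction q using Path.Homotopic.Quotient.ind
  exact Path.Homotopic.Quotient.eq.mpr (hΦ.homotopic h)

theorem IsFaithful.gauge {Φ : PathHom Y H} (hΦ : Φ.IsFaithful) (g : Y → H) :
    (Φ.gauge g).IsFaithful := by
  intro x p hp
  refine hΦ p ?_
  simpa using hp

/-- The path homomorphism defined by a homomorphism on the fundamental group and a choice of paths
from the base point. -/
def ofMonoidHom {x : Y} (f : FundamentalGroup Y x →* H) (c : ∀ y, Path x y) : PathHom Y H where
  toFun γ := f (Path.Homotopic.Quotient.mk
    (((c (γ 0)).trans ⟨γ, rfl, rfl⟩).trans (c (γ 1)).symm))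
  map_trans' {y z w} p q := by
    have key : ∀ {y z : Y} (p : Path y z), f (Path.Homotopic.Quotient.mk
        (((c (p.toContinuousMap 0)).trans ⟨p.toContinuousMap, rfl, rfl⟩).trans
          (c (p.toContinuousMap 1)).symm)) =
        f (Path.Homotopic.Quotient.mk (((c y).trans p).trans (c z).symm)) := by
      rintro y z ⟨p, rfl, rfl⟩
      rfl
    rw [key, key, key, ← map_mul, FundamentalGroup.mul_def]
    congr 1
    simp only [Path.Homotopic.Quotient.mk_trans, Path.Homotopic.Quotient.mk_symm,
      Path.Homotopic.Quotient.trans_assoc]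
    rw [← Path.Homotopic.Quotient.trans_assoc (Path.Homotopic.Quotient.mk (c z)).symm,
      Path.Homotopic.Quotient.symm_trans, Path.Homotopic.Quotient.refl_trans]
  map_homotopic' {y z p q} h := by
    obtain ⟨p, rfl, rfl⟩ := p
    obtain ⟨q, hq, hq'⟩ := q
    have key : ∀ {y z : Y} (c₀ : Path x y) (c₁ : Path x z) {p q : Path y z}, p.Homotopic q →
        f (Path.Homotopic.Quotient.mk ((c₀.trans p).trans c₁.symm)) =
        f (Path.Homotopic.Quotient.mk ((c₀.trans q).trans c₁.symm)) := by
      intro y z c₀ c₁ p q h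
      simp only [Path.Homotopic.Quotient.mk_trans]
      rw [Path.Homotopic.Quotient.eq.mpr h]
    have key' : ∀ {y z : Y} (hq : q 0 = y) (hq' : q 1 = z),
        f (Path.Homotopic.Quotient.mk (((c (q 0)).trans ⟨q, rfl, rfl⟩).trans (c (q 1)).symm)) =
        f (Path.Homotopic.Quotient.mk (((c y).trans ⟨q, hq, hq'⟩).trans (c z).symm)) := by
      rintro y z rfl rfl
      rfl
    exact (key _ _ h).trans (key' hq hq').symm

theorem ofMonoidHom_apply {x : Y} (f : FundamentalGroup Y x →* H) (c : ∀ y, Path x y)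
    {y z : Y} (p : Path y z) : ofMonoidHom f c p.toContinuousMap =
      f (Path.Homotopic.Quotient.mk (((c y).trans p).trans (c z).symm)) := by
  obtain ⟨p, rfl, rfl⟩ := p
  rfl

theorem ofMonoidHom_isFaithful {x : Y} {f : FundamentalGroup Y x →* H} (c : ∀ y, Path x y)
    (hf : Function.Injective f) : (ofMonoidHom f c).IsFaithful := by
  intro y p hp
  rw [ofMonoidHom_apply] at hp
  have h1 := hf (hp.trans (map_one f).symm)
  rw [FundamentalGroup.one_def] at h1
  rw [← Path.Homotopic.Quotient.eq, Path.Homotopic.Quotient.mk_refl]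
  simp only [Path.Homotopic.Quotient.mk_trans, Path.Homotopic.Quotient.mk_symm] at h1
  have h2 := congrArg (fun r => ((Path.Homotopic.Quotient.mk (c y)).symm.trans r).trans
    (Path.Homotopic.Quotient.mk (c y))) h1
  simp only [← Path.Homotopic.Quotient.trans_assoc, Path.Homotopic.Quotient.symm_trans,
    Path.Homotopic.Quotient.refl_trans] at h2
  rwa [Path.Homotopic.Quotient.trans_assoc, Path.Homotopic.Quotient.symm_trans,
    Path.Homotopic.Quotient.trans_refl, Path.Homotopic.Quotient.trans_refl,
    Path.Homotopic.Quotient.symm_trans] at h2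

/-- On the fundamental group at the base point, the path homomorphism is the given homomorphism,
if the target is commutative. -/
theorem ofMonoidHom_toMonoidHom {H : Type*} [CommGroup H] {x : Y} (f : FundamentalGroup Y x →* H)
    (c : ∀ y, Path x y) (p : FundamentalGroup Y x) : (ofMonoidHom f c).toMonoidHom x p = f p := by
  induction p using Path.Homotopic.Quotient.ind with | mk p =>
  rw [toMonoidHom_mk, ofMonoidHom_apply]
  let d : FundamentalGroup Y x := Path.Homotopic.Quotient.mk (c x)
  have : (Path.Homotopic.Quotient.mk (((c x).trans p).trans (c x).symm) : FundamentalGroup Y x) =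
      d⁻¹ * (FundamentalGroup.fromPath (Path.Homotopic.Quotient.mk p) * d) := rfl
  rw [this, map_mul, map_mul, map_inv]
  rw [mul_comm (f _) (f d), inv_mul_cancel_left]

/-- A free homotopy is an annulus. Cut open along the track of the base point it is a square, and
`g` is the value on that track. -/
theorem loop_mul_evalAt (Φ : PathHom Y H) {c c' : C(Circle, Y)} (F : c.Homotopy c') :
    ∃ g, g * Φ.loop c = Φ.loop c' * g := by
  have := Φ.map_square
    (F.toContinuousMap.comp (ContinuousMap.snd.prodMk (circleLoop.comp ContinuousMap.fst)))
  refine ⟨Φ (F.evalAt 1).toContinuousMap, Eq.trans ?_ (this.trans ?_)⟩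
  · refine congrArg₂ (· * ·) (congrArg Φ.toFun (ContinuousMap.ext fun s => ?_))
      (congrArg Φ.toFun (ContinuousMap.ext fun s => ?_))
    · simp [circleLoop, ContinuousMap.Homotopy.evalAt]
    · simp
  · refine congrArg₂ (· * ·) (congrArg Φ.toFun (ContinuousMap.ext fun s => ?_))
      (congrArg Φ.toFun (ContinuousMap.ext fun s => ?_))
    · simp
    · simp [circleLoop, ContinuousMap.Homotopy.evalAt]

theorem loop_eq_of_homotopic {H : Type*} [CommGroup H] (Φ : PathHom Y H) {c c' : C(Circle, Y)}
    (h : c.Homotopic c') : Φ.loop c = Φ.loop c' := by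
  obtain ⟨F⟩ := h
  obtain ⟨g, hg⟩ := Φ.loop_mul_evalAt F
  rwa [mul_comm, mul_left_inj] at hg

theorem loop_eq_one_of_nullhomotopic (Φ : PathHom Y H) {c : C(Circle, Y)}
    (h : c.Nullhomotopic) : Φ.loop c = 1 := by
  obtain ⟨y, ⟨F⟩⟩ := h
  obtain ⟨g, hg⟩ := Φ.loop_mul_evalAt F
  have : Φ.loop (.const Circle y) = 1 := Φ.map_const y
  rw [this, one_mul] at hg
  exact mul_eq_left.mp hg

/-- On the universal cover `ℝ` the `n`-fold curve is the segment of length `2πn`. It splits into `n`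
translates of one period, so the claim follows by induction in both directions. -/
theorem loop_circlePow (Φ : PathHom Y H) (c : C(Circle, Y)) (n : ℤ) :
    Φ.loop (c.comp (circlePow n)) = Φ.loop c ^ n := by
  let h : C(ℝ, Y) := c.comp ⟨Circle.exp, by fun_prop⟩
  have hseg : ∀ n : ℤ, Φ.loop (c.comp (circlePow n)) =
      Φ (segmentMap h 0 (n * (2 * Real.pi))) := by
    intro n
    unfold loop
    congr 1
    ext s
    simp only [segmentMap, ContinuousMap.comp_apply, Path.coe_toContinuousMap]
    rw [Path.segment_apply]
    simp only [h, circlePow, circleLoop, ContinuousMap.coe_mk, ContinuousMap.comp_apply]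
    congr 1
    rw [← Circle.exp_zsmul]
    congr 1
    simp [AffineMap.lineMap_apply]
    ring
  have h1 : Φ.loop c = Φ (segmentMap h 0 (2 * Real.pi)) := by
    have := hseg 1
    rw [Int.cast_one, one_mul] at this
    rw [← this]
    congr 1
    ext s
    simp [circlePow]
  have hshift : ∀ n : ℤ, segmentMap h (n * (2 * Real.pi)) ((n + 1 : ℤ) * (2 * Real.pi)) =
      segmentMap h 0 (2 * Real.pi) := by
    intro n
    ext s
    simp only [segmentMap, ContinuousMap.comp_apply, Path.coe_toContinuousMap]
    rw [Path.segment_apply, Path.segment_apply]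
    simp only [h, ContinuousMap.coe_mk, ContinuousMap.comp_apply]
    congr 1
    refine Eq.trans ?_ (Circle.periodic_exp.int_mul n _)
    congr 1
    simp only [AffineMap.lineMap_apply, vsub_eq_sub, smul_eq_mul, vadd_eq_add]
    push_cast
    ring
  have hstep : ∀ n : ℤ, Φ.loop (c.comp (circlePow (n + 1))) =
      Φ.loop c * Φ.loop (c.comp (circlePow n)) := by
    intro n
    rw [hseg, hseg, h1, ← hshift n]
    exact Φ.segment_trans _ _ _ _
  induction n with
  | zero =>
    rw [zpow_zero, hseg, Int.cast_zero, zero_mul]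
    exact Φ.isLocalPathHom.segment_self h (mem_univ _)
  | succ n ih => rw [hstep, ih, ← zpow_one_add, add_comm]
  | pred n ih =>
    have := hstep (-(n : ℤ) - 1)
    rw [sub_add_cancel, ih] at this
    rw [zpow_sub_one, ← Commute.eq (Commute.inv_left (Commute.self_zpow _ _)), this,
      inv_mul_cancel_left]

end PathHom

/-! ### Degrees of paths in the circle and the torus -/

/-- The standard loop in the circle. -/
def circleLoopPath : Path (1 : Circle) 1 := ⟨circleLoop, by simp [circleLoop], by simp [circleLoop]⟩

/-- The deck transformations of `exp : ℝ → S¹` form `2πℤ`, and the standard loop lifts to the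
segment from `0` to `2π`, hence gives the generator. -/
theorem exists_fundamentalGroup_circle_hom : ∃ f : FundamentalGroup Circle 1 →* Multiplicative ℤ,
    Function.Injective f ∧
      f (Path.Homotopic.Quotient.mk circleLoopPath) = .ofAdd 1 := by
  let hp := Circle.isAddQuotientCoveringMap_exp
  let e : Circle.exp ⁻¹' {1} := ⟨0, by simp⟩
  let τ : AddSubgroup.zmultiples (2 * Real.pi) := ⟨2 * Real.pi, AddSubgroup.mem_zmultiples _⟩
  let E : FundamentalGroup Circle 1 ≃* (Multiplicative (AddSubgroup.zmultiples (2 * Real.pi)))ᵐᵒᵖ :=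
    hp.fundamentalGroupEquiv e
  let Z : ℤ ≃+ AddSubgroup.zmultiples (2 * Real.pi) := AddEquiv.ofBijective (zmultiplesHom _ τ) (by
    constructor
    · rw [injective_iff_map_eq_zero]
      intro n hn
      have := congrArg Subtype.val hn
      simpa [τ, Real.pi_ne_zero] using this
    · rintro ⟨x, n, rfl⟩
      exact ⟨n, by ext; simp [τ]⟩)
  let f := (E.trans MulOpposite.opMulEquiv.symm).trans (AddEquiv.toMultiplicative Z.symm)
  refine ⟨f.toMonoidHom, f.injective, ?_⟩
  have h1 : E (Path.Homotopic.Quotient.mk circleLoopPath) =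
      MulOpposite.op (Multiplicative.ofAdd τ) := by
    refine hp.fundamentalGroupToMulOpposite_apply_eq_Iff.mpr ?_
    let e' : Circle.exp ⁻¹' {1} := ⟨2 * Real.pi, by simp⟩
    rw [hp.isCoveringMap.monodromy_eq_of_map_eq (ey := e')
      (Path.Homotopic.Quotient.mk (Path.segment 0 (2 * Real.pi)))]
    · change (τ : ℝ) + 0 = 2 * Real.pi
      simp [τ]
    · refine congrArg Path.Homotopic.Quotient.mk ?_
      ext1
      funext s
      change Circle.exp (Path.segment 0 (2 * Real.pi) s) = Circle.exp (2 * Real.pi * s)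
      rw [Path.segment_apply]
      simp [AffineMap.lineMap_apply, mul_comm]
  change Multiplicative.ofAdd (Z.symm (Multiplicative.toAdd (MulOpposite.unop (E _)))) = _
  rw [h1]
  congr 1
  rw [AddEquiv.symm_apply_eq]
  exact (one_zsmul τ).symm

instance : PathConnectedSpace Circle := by
  refine ⟨⟨1⟩, fun x y => ?_⟩
  obtain ⟨a, rfl⟩ := Circle.exp_surjective x
  obtain ⟨b, rfl⟩ := Circle.exp_surjective y
  exact ⟨(Path.segment a b).map (by fun_prop)⟩

theorem exists_circleDegree : ∃ D : PathHom Circle (Multiplicative ℤ), D.IsFaithful ∧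
    D.loop (.id Circle) = .ofAdd 1 := by
  obtain ⟨f, hf, h1⟩ := exists_fundamentalGroup_circle_hom
  refine ⟨.ofMonoidHom f fun y => PathConnectedSpace.somePath 1 y,
    PathHom.ofMonoidHom_isFaithful _ hf, ?_⟩
  rw [← h1]
  exact PathHom.ofMonoidHom_toMonoidHom f _ (Path.Homotopic.Quotient.mk circleLoopPath)

/-- The degree of paths in the circle. -/
def circleDegree : PathHom Circle (Multiplicative ℤ) := exists_circleDegree.choose

theorem circleDegree_isFaithful : circleDegree.IsFaithful := exists_circleDegree.choose_spec.1

theorem circleDegree_loop_id : circleDegree.loop (.id Circle) = .ofAdd 1 :=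
  exists_circleDegree.choose_spec.2

/-- The bidegree of paths in the torus. -/
def torusDegree : PathHom Torus (Multiplicative (ℤ × ℤ)) where
  toFun γ := .ofAdd ((circleDegree (ContinuousMap.fst.comp γ)).toAdd,
    (circleDegree (ContinuousMap.snd.comp γ)).toAdd)
  map_trans' p q := by
    have h1 := (circleDegree.comap ContinuousMap.fst).map_trans p q
    have h2 := (circleDegree.comap ContinuousMap.snd).map_trans p q
    simp only [PathHom.comap_apply] at h1 h2
    rw [h1, h2]
    rfl
  map_homotopic' h := by
    have h1 := (circleDegree.comap ContinuousMap.fst).map_homotopic h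
    have h2 := (circleDegree.comap ContinuousMap.snd).map_homotopic h
    simp only [PathHom.comap_apply] at h1 h2
    rw [h1, h2]

theorem torusDegree_isFaithful : torusDegree.IsFaithful := by
  intro x p hp
  have h1 := congrArg (fun y => Multiplicative.ofAdd (Prod.fst (Multiplicative.toAdd y))) hp
  have h2 := congrArg (fun y => Multiplicative.ofAdd (Prod.snd (Multiplicative.toAdd y))) hp
  exact Path.homotopic_of_map_fst_of_map_snd
    (circleDegree_isFaithful (p.map continuous_fst) h1)
    (circleDegree_isFaithful (p.map continuous_snd) h2)

/-! ### Primitive curves and gluing maps on the torus -/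

/-- The curve `s ↦ (s ^ a, s ^ b)` on the torus. -/
def torusCurve (a b : ℤ) : C(Circle, Torus) := (circlePow a).prodMk (circlePow b)

theorem torusDegree_loop_torusCurve (a b : ℤ) :
    torusDegree.loop (torusCurve a b) = .ofAdd (a, b) := by
  have h : ∀ n, circleDegree.loop (circlePow n) = .ofAdd n := by
    intro n
    have := circleDegree.loop_circlePow (.id Circle) n
    rw [circleDegree_loop_id, ContinuousMap.id_comp] at this
    rw [this, ← ofAdd_zsmul, smul_eq_mul, mul_one]
  have h1 := h a
  have h2 := h b
  change Multiplicative.ofAdd ((circleDegree.loop (circlePow a)).toAdd,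
    (circleDegree.loop (circlePow b)).toAdd) = _
  rw [h1, h2]
  rfl

theorem torusCurve_one (a b : ℤ) : torusCurve a b 1 = 1 := by
  simp [torusCurve, circlePow]

theorem ContMDiff.circle_zpow {E H M : Type*} [NormedAddCommGroup E] [NormedSpace ℝ E]
    [TopologicalSpace H] {J : ModelWithCorners ℝ E H} [TopologicalSpace M] [ChartedSpace H M]
    {f : M → Circle} (hf : ContMDiff J (𝓡 1) ∞ f) (n : ℤ) :
    ContMDiff J (𝓡 1) ∞ fun x => f x ^ n := by
  cases n with
  | ofNat n => simpa using hf.pow n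
  | negSucc n => simpa using (hf.pow (n + 1)).inv

theorem zpow_mul_zpow_mul_zpow {G : Type*} [CommGroup G] (x y : G) {a b c d e f r s : ℤ}
    (hr : a * e + b * f = r) (hs : c * e + d * f = s) :
    (x ^ a * y ^ c) ^ e * (x ^ b * y ^ d) ^ f = x ^ r * y ^ s := by
  subst hr hs
  simp only [mul_zpow, ← zpow_mul, zpow_add]
  exact mul_mul_mul_comm _ _ _ _

/-- The automorphism of the torus defined by a matrix of determinant one. -/
def torusAutomorphism (a b c d : ℤ) (h : a * d - b * c = 1) :
    Diffeomorph torusModel torusModel Torus Torus ∞ where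
  toFun x := (x.1 ^ a * x.2 ^ c, x.1 ^ b * x.2 ^ d)
  invFun x := (x.1 ^ d * x.2 ^ (-c), x.1 ^ (-b) * x.2 ^ a)
  left_inv x := by
    refine Prod.ext ?_ ?_
    · exact (zpow_mul_zpow_mul_zpow x.1 x.2 (r := 1) (s := 0) (by linarith) (by ring)).trans (by simp)
    · exact (zpow_mul_zpow_mul_zpow x.1 x.2 (r := 0) (s := 1) (by ring) (by linarith)).trans (by simp)
  right_inv x := by
    refine Prod.ext ?_ ?_
    · exact (zpow_mul_zpow_mul_zpow x.1 x.2 (r := 1) (s := 0) (by linarith) (by ring)).trans (by simp)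
    · exact (zpow_mul_zpow_mul_zpow x.1 x.2 (r := 0) (s := 1) (by ring) (by linarith)).trans (by simp)
  contMDiff_toFun := ((contMDiff_fst.circle_zpow a).mul (contMDiff_snd.circle_zpow c)).prodMk
    ((contMDiff_fst.circle_zpow b).mul (contMDiff_snd.circle_zpow d))
  contMDiff_invFun := ((contMDiff_fst.circle_zpow d).mul (contMDiff_snd.circle_zpow (-c))).prodMk
    ((contMDiff_fst.circle_zpow (-b)).mul (contMDiff_snd.circle_zpow a))

@[simp]
theorem torusAutomorphism_apply (a b c d : ℤ) (h : a * d - b * c = 1) (x : Torus) :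
    torusAutomorphism a b c d h x = (x.1 ^ a * x.2 ^ c, x.1 ^ b * x.2 ^ d) := rfl

/-- The image of a factor circle under a diffeomorphism of the torus is smoothly embedded. -/
theorem Diffeomorph.isSmoothEmbedding_circle (A : Diffeomorph torusModel torusModel Torus Torus ∞) :
    IsSmoothEmbedding (𝓡 1) torusModel ∞ fun s : Circle => A (s, 1) := by
  have hcont : Continuous fun s : Circle => A (s, 1) := A.continuous.comp (by fun_prop)
  refine ⟨⟨EuclideanSpace ℝ (Fin 1), inferInstance, inferInstance, fun s => ?_⟩,
    (hcont.isClosedEmbedding fun s t h => by simpa using A.injective h).isEmbedding⟩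
  let c := chartAt (EuclideanSpace ℝ (Fin 1)) (1 : Circle)
  let v := c 1
  -- The translation moves the second chart coordinate of the point `1` to `0`, so that in the
  -- charts the circle becomes `x ↦ (x, 0)`, the normal form of an immersion.
  let τ : ModelProd (EuclideanSpace ℝ (Fin 1)) (EuclideanSpace ℝ (Fin 1)) ≃ₜ
      ModelProd (EuclideanSpace ℝ (Fin 1)) (EuclideanSpace ℝ (Fin 1)) :=
    (Homeomorph.refl _).prodCongr (Homeomorph.addRight (-v))
  have hτ : ContMDiff torusModel torusModel ∞ τ := by
    have h : ContMDiff torusModel torusModel ∞ fun x : EuclideanSpace ℝ (Fin 1) ×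
        EuclideanSpace ℝ (Fin 1) => (x.1, x.2 + -v) := contMDiff_fst.prodMk
      ((contDiff_id.add contDiff_const).contMDiff.comp contMDiff_snd)
    convert! h using 1 <;> exact chartedSpaceSelf_prod.symm
  have hτ' : ContMDiff torusModel torusModel ∞ τ.symm := by
    have h : ContMDiff torusModel torusModel ∞ fun x : EuclideanSpace ℝ (Fin 1) ×
        EuclideanSpace ℝ (Fin 1) => (x.1, x.2 + -(-v)) := contMDiff_fst.prodMk
      ((contDiff_id.add contDiff_const).contMDiff.comp contMDiff_snd)
    convert! h using 1 <;> exact chartedSpaceSelf_prod.symm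
  let p := chartAt (ModelProd (EuclideanSpace ℝ (Fin 1)) (EuclideanSpace ℝ (Fin 1)))
    ((s, 1) : Torus)
  let cod : OpenPartialHomeomorph Torus
      (ModelProd (EuclideanSpace ℝ (Fin 1)) (EuclideanSpace ℝ (Fin 1))) :=
    A.symm.toHomeomorph.toOpenPartialHomeomorph ≫ₕ (p ≫ₕ τ.toOpenPartialHomeomorph)
  refine IsImmersionAtOfComplement.mk_of_continuousAt hcont.continuousAt
    (ContinuousLinearEquiv.refl ℝ _) (chartAt _ s) cod (mem_chart_source _ s) ?_
    (IsManifold.chart_mem_maximalAtlas s) ?_ ?_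
  · simp [cod, p]
  · refine cod.mem_maximalAtlas_of_contMDiffOn ?_ ?_
    · exact hτ.comp_contMDiffOn ((contMDiffOn_chart (x := ((s, 1) : Torus))).comp
        A.symm.contMDiff.contMDiffOn fun x hx => by simpa [cod, p] using hx)
    · exact A.contMDiff.comp_contMDiffOn ((contMDiffOn_chart_symm (x := ((s, 1) : Torus))).comp
        hτ'.contMDiffOn fun x hx => by simpa [cod, p] using hx)
  · intro x hx
    have hx' : x ∈ (chartAt (EuclideanSpace ℝ (Fin 1)) s).target := by simpa using hx
    simp [cod, p, hx']
    exact Prod.ext rfl (add_neg_cancel v)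

/-- Bézout coefficients complete `(a, b)` to a matrix of determinant one, whose automorphism carries
a factor circle to the curve. If the curve is homotopic to a `k`-fold multiple, comparing bidegrees
shows that `k` divides both `a` and `b`. -/
theorem torusCurve_isPrimitiveCurve {a b : ℤ} (h : IsCoprime a b) :
    IsPrimitiveCurve (torusCurve a b) := by
  constructor
  · obtain ⟨u, v, huv⟩ := h
    convert! (torusAutomorphism a b (-v) u (by linarith)).isSmoothEmbedding_circle using 1
    ext s <;> simp [torusCurve, circlePow]
  · intro δ k hk
    have h1 := torusDegree.loop_eq_of_homotopic hk
    rw [torusDegree.loop_circlePow, torusDegree_loop_torusCurve] at h1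
    have h2 := congrArg Multiplicative.toAdd h1
    rw [toAdd_ofAdd, toAdd_zpow] at h2
    exact h.isUnit_of_dvd' ⟨_, congrArg Prod.fst h2⟩ ⟨_, congrArg Prod.snd h2⟩

/-- The shear `(x, s) ↦ (x γ(s ^ q), s)` works; its inverse comes from the group structure of the
torus. -/
theorem exists_isSurgeryGluing {a b : ℤ} (h : IsCoprime a b) (q : ℤ) :
    ∃ φ, IsSurgeryGluing 1 q (torusCurve a b) φ := by
  have hγ : ContMDiff (𝓡 1) torusModel ∞ (torusCurve a b) :=
    (torusCurve_isPrimitiveCurve h).embedding.contMDiff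
  have hpow : ContMDiff (𝓡 1) (𝓡 1) ∞ fun s : Circle => s ^ q := contMDiff_id.circle_zpow q
  have hγ' : ContMDiff (torusModel.prod (𝓡 1)) torusModel ∞
      fun x : Torus × Circle => torusCurve a b (x.2 ^ q) := hγ.comp (hpow.comp contMDiff_snd)
  refine ⟨{ toFun := fun x => (x.1 * torusCurve a b (x.2 ^ q), x.2)
            invFun := fun x => (x.1 * (torusCurve a b (x.2 ^ q))⁻¹, x.2)
            left_inv := fun x => by simp
            right_inv := fun x => by simp
            contMDiff_toFun := (contMDiff_fst.mul hγ').prodMk contMDiff_snd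
            contMDiff_invFun := (contMDiff_fst.mul hγ'.inv).prodMk contMDiff_snd }, ?_⟩
  unfold IsSurgeryGluing
  convert! ContinuousMap.Homotopic.refl _ using 1
  refine ContinuousMap.ext fun s => Prod.ext ?_ ?_
  · exact (one_mul (torusCurve a b (s ^ q))).symm
  · exact zpow_one s

/-! ### Countability and separation for fillings -/

namespace IsFilling

variable {A P Y : Type*} [TopologicalSpace A] [TopologicalSpace P] [TopologicalSpace Y]
  {j : C(A, Y)} {k : C(P × ℂ, Y)} {e : C(P × PuncturedPlane, A)}

theorem secondCountableTopology (h : IsFilling j k e) [SecondCountableTopology A]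
    [SecondCountableTopology P] : SecondCountableTopology Y := by
  have (b : Bool) : SecondCountableTopology ↥(cond b (range j) (range k)) := by
    cases b
    · exact h.right.toIsEmbedding.toHomeomorph.symm.isEmbedding.secondCountableTopology
    · exact h.left.toIsEmbedding.toHomeomorph.symm.isEmbedding.secondCountableTopology
  refine TopologicalSpace.secondCountableTopology_of_countable_cover
    (U := fun b : Bool => cond b (range j) (range k)) (fun b => ?_) ?_
  · cases b
    exacts [h.right.isOpen_range, h.left.isOpen_range]
  · refine eq_univ_of_forall fun y => mem_iUnion.2 ?_
    rcases h.cover y with hy | hy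
    exacts [⟨true, hy⟩, ⟨false, hy⟩]

/-- The only delicate pair is a point of `A` and a point of a core. If the former lies in the tube,
they are separated there; otherwise the open unit tube and the complement in `A` of the closed one,
open by `he`, do it. -/
theorem t2Space (h : IsFilling j k e) [T2Space A] [T2Space P]
    (he : IsClosed (e '' {x | ‖(x.2 : ℂ)‖ ≤ 1})) : T2Space Y := by
  have hlr {u : A} {x : P × ℂ} (hx : x.2 = 0) : ∃ U V : Set Y, IsOpen U ∧ IsOpen V ∧
      j u ∈ U ∧ k x ∈ V ∧ Disjoint U V := by
    by_cases hu : j u ∈ range k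
    · obtain ⟨x', hx'⟩ := hu
      have hne : x' ≠ x := by
        rintro rfl
        obtain ⟨t, z⟩ := x'
        subst hx
        exact h.core t ⟨u, hx'.symm⟩
      obtain ⟨U, V, hU, hV, hxU, hxV, hUV⟩ := t2_separation hne
      exact ⟨k '' U, k '' V, h.right.isOpenMap U hU, h.right.isOpenMap V hV, ⟨x', hxU, hx'⟩,
        ⟨x, hxV, rfl⟩, (disjoint_image_iff h.right.injective).2 hUV⟩
    · refine ⟨j '' (e '' {x | ‖(x.2 : ℂ)‖ ≤ 1})ᶜ, k '' {x | ‖x.2‖ < 1},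
        h.left.isOpenMap _ he.isOpen_compl,
        h.right.isOpenMap _ (isOpen_lt (by fun_prop) continuous_const), ⟨u, ?_, rfl⟩,
        ⟨x, by simp [hx], rfl⟩, ?_⟩
      · rintro ⟨⟨t, z⟩, -, rfl⟩
        exact hu ⟨(t, z), (h.comm t z).symm⟩
      · rw [disjoint_left]
        rintro _ ⟨a, ha, rfl⟩ ⟨⟨t, z⟩, hz, hza⟩
        have hz0 : z ≠ 0 := by
          rintro rfl
          exact h.core t ⟨a, hza.symm⟩
        refine ha ⟨(t, ⟨z, hz0⟩), (mem_ball_zero_iff.1 (mem_ball_zero_iff.2 hz)).le, h.left.injective ?_⟩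
        rw [h.comm, ← hza]
  have hor (y : Y) : y ∈ range j ∨ ∃ x : P × ℂ, x.2 = 0 ∧ k x = y := by
    rcases h.cover y with hy | ⟨⟨t, z⟩, rfl⟩
    · exact .inl hy
    · by_cases hz : z = 0
      · exact .inr ⟨_, hz, rfl⟩
      · exact .inl ⟨_, h.comm t ⟨z, hz⟩⟩
  refine ⟨fun a b hab => ?_⟩
  rcases hor a with ⟨u, rfl⟩ | ⟨x, hx, rfl⟩ <;> rcases hor b with ⟨v, rfl⟩ | ⟨y, hy, rfl⟩
  · obtain ⟨U, V, hU, hV, hxU, hxV, hUV⟩ := t2_separation (ne_of_apply_ne j hab)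
    exact ⟨j '' U, j '' V, h.left.isOpenMap U hU, h.left.isOpenMap V hV, ⟨u, hxU, rfl⟩,
      ⟨v, hxV, rfl⟩, (disjoint_image_iff h.left.injective).2 hUV⟩
  · exact hlr hy
  · obtain ⟨U, V, hU, hV, hxU, hxV, hUV⟩ := hlr (u := v) hx
    exact ⟨V, U, hV, hU, hxV, hxU, hUV.symm⟩
  · obtain ⟨U, V, hU, hV, hxU, hxV, hUV⟩ := t2_separation (ne_of_apply_ne k hab)
    exact ⟨k '' U, k '' V, h.right.isOpenMap U hU, h.right.isOpenMap V hV, ⟨x, hxU, rfl⟩,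
      ⟨y, hxV, rfl⟩, (disjoint_image_iff h.right.injective).2 hUV⟩

end IsFilling

/-! ### Gluing smooth structures -/

section SmoothGluing

variable {E H M : Type*} [NormedAddCommGroup E] [NormedSpace ℝ E] [TopologicalSpace H]
  {J : ModelWithCorners ℝ E H} [TopologicalSpace M] [ChartedSpace H M]

theorem TopologicalSpace.Opens.isLocalDiffeomorph_val (U : TopologicalSpace.Opens M) :
    IsLocalDiffeomorph J J ∞ (Subtype.val : U → M) := by
  intro x
  have : Nonempty U := ⟨x⟩
  have hopen := U.isOpen.isOpenEmbedding_subtypeVal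
  let f := hopen.toOpenPartialHomeomorph
  refine ⟨{ toPartialEquiv := f.toPartialEquiv
            open_source := f.open_source
            open_target := f.open_target
            contMDiffOn_toFun := contMDiff_subtype_val.contMDiffOn
            contMDiffOn_invFun := fun y hy => ?_ }, mem_univ x, fun y _ => rfl⟩
  refine (ContMDiffWithinAt.subtypeVal_comp_iff U _ _ _).1
    (contMDiffWithinAt_id.congr (fun z hz => f.right_inv hz) (f.right_inv hy))

/-- A smooth structure obtained by gluing open subsets of a manifold along smooth
transition maps. -/
theorem exists_chartedSpace_of_openPartialHomeomorph [IsManifold J ∞ M] {S κ : Type*}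
    [TopologicalSpace S] (e : κ → OpenPartialHomeomorph M S)
    (hcover : ∀ x : S, ∃ i, x ∈ (e i).target)
    (hsmooth : ∀ i j, ContMDiffOn J J ∞ (e i ≫ₕ (e j).symm) (e i ≫ₕ (e j).symm).source) :
    ∃ _ : ChartedSpace H S, IsManifold J ∞ S ∧
      ∀ i, ∀ x ∈ (e i).source, IsLocalDiffeomorphAt J J ∞ (e i) x := by
  choose i hi using hcover
  let C : ChartedSpace H S :=
    { atlas := {c | ∃ j, ∃ c' ∈ atlas H M, c = (e j).symm ≫ₕ c'}
      chartAt := fun x => (e (i x)).symm ≫ₕ chartAt H ((e (i x)).symm x)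
      mem_chart_source := fun x => by simp [hi x]
      chart_mem_atlas := fun x => ⟨_, _, chart_mem_atlas H _, rfl⟩ }
  -- A chart of `M` precomposed with a smooth transition map is again a chart of `M`. Compatibility
  -- of the charts of `S` thus reduces to compatibility in `M`.
  have hmax : ∀ i j, ∀ c ∈ atlas H M, (e i ≫ₕ (e j).symm) ≫ₕ c ∈ IsManifold.maximalAtlas J ∞ M := by
    intro i j c hc
    have hc' : c ∈ IsManifold.maximalAtlas J ∞ M := IsManifold.subset_maximalAtlas hc
    refine OpenPartialHomeomorph.mem_maximalAtlas_of_contMDiffOn _ ?_ ?_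
    · refine (contMDiffOn_of_mem_maximalAtlas hc').comp
        ((hsmooth i j).mono fun x hx => ?_) fun x hx => ?_
      · rw [OpenPartialHomeomorph.trans_source] at hx
        exact hx.1
      · rw [OpenPartialHomeomorph.trans_source] at hx
        exact hx.2
    · have h1 := hsmooth j i
      rw [OpenPartialHomeomorph.coe_trans_symm]
      refine ContMDiffOn.comp (t := (e j ≫ₕ (e i).symm).source) ?_
        ((contMDiffOn_symm_of_mem_maximalAtlas hc').mono fun x hx => ?_) fun x hx => ?_
      · exact h1
      · rw [OpenPartialHomeomorph.trans_target] at hx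
        exact hx.1
      · rw [OpenPartialHomeomorph.trans_target] at hx
        have := hx.2
        simpa [OpenPartialHomeomorph.trans_target, OpenPartialHomeomorph.trans_source] using this
  have : IsManifold J ∞ S := by
    refine { compatible := ?_ }
    rintro _ _ ⟨j, c, hc, rfl⟩ ⟨j', c', hc', rfl⟩
    have hc₁ : c ∈ IsManifold.maximalAtlas J ∞ M := IsManifold.subset_maximalAtlas hc
    have := StructureGroupoid.compatible_of_mem_maximalAtlas hc₁ (hmax j j' c' hc')
    rw [OpenPartialHomeomorph.trans_symm_eq_symm_trans_symm, OpenPartialHomeomorph.symm_symm]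
    simpa only [OpenPartialHomeomorph.trans_assoc] using this
  refine ⟨C, inferInstance, fun j x hx => ?_⟩
  have hchart (x : M) : (e j).symm ≫ₕ chartAt H x ∈ IsManifold.maximalAtlas J ∞ S :=
    IsManifold.subset_maximalAtlas ⟨j, _, chart_mem_atlas H x, rfl⟩
  refine ⟨{ toPartialEquiv := (e j).toPartialEquiv
            open_source := (e j).open_source
            open_target := (e j).open_target
            contMDiffOn_toFun := fun y hy => ?_
            contMDiffOn_invFun := fun y hy => ?_ }, hx, fun y _ => rfl⟩
  · have h1 := contMDiffAt_symm_of_mem_maximalAtlas (x := chartAt H y y) (hchart y)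
      (by simp; exact hy)
    have h2 : ContMDiffAt J J ∞ (chartAt H y) y :=
      contMDiffAt_of_mem_maximalAtlas (IsManifold.chart_mem_maximalAtlas y) (mem_chart_source H y)
    refine ((h1.comp y h2).congr_of_eventuallyEq ?_).contMDiffWithinAt
    filter_upwards [(chartAt H y).open_source.mem_nhds (mem_chart_source H y)] with z hz
    simp [hz]
  · have hy' : y ∈ (e j).target := hy
    set x := (e j).symm y
    have h1 := contMDiffAt_of_mem_maximalAtlas (x := y) (hchart x) (by simp [hy', x])
    have h2 : ContMDiffAt J J ∞ (chartAt H x).symm (chartAt H x x) :=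
      contMDiffAt_symm_of_mem_maximalAtlas (IsManifold.chart_mem_maximalAtlas x) (by simp)
    refine ((h2.comp y h1).congr_of_eventuallyEq ?_).contMDiffWithinAt
    filter_upwards [((e j).symm ≫ₕ chartAt H x).open_source.mem_nhds
      (show y ∈ _ by simp [hy', x])] with z hz
    simp only [OpenPartialHomeomorph.trans_source] at hz
    exact ((chartAt H x).left_inv hz.2).symm

end SmoothGluing

/-! ### Radial extension of gluing maps -/

section Radial

/-- The direction of a complex number. -/
def Complex.direction (z : ℂ) : Circle := Circle.exp z.arg

@[simp]
theorem Complex.norm_mul_direction (z : ℂ) : (‖z‖ : ℂ) * z.direction = z := by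
  rw [Complex.direction, Circle.coe_exp, Complex.norm_mul_exp_arg_mul_I]

theorem Complex.direction_real_mul {r : ℝ} (hr : 0 < r) (s : Circle) :
    Complex.direction (r * s) = s := by
  rw [Complex.direction, Complex.arg_real_mul _ hr, Circle.exp_arg]

theorem Complex.direction_eq_iff {z : ℂ} (hz : z ≠ 0) {s : Circle} :
    z.direction = s ↔ z = ‖z‖ * s := by
  constructor
  · rintro rfl
    exact z.norm_mul_direction.symm
  · intro h
    rw [h]
    exact Complex.direction_real_mul (norm_pos_iff.2 hz) s

/-- The argument jumps on the negative axis, so it is measured relative to `z`: for `w` near `z` the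
quotient `w / z` is near `1`, where the logarithm is smooth. -/
theorem Complex.contMDiffAt_direction {z : ℂ} (hz : z ≠ 0) :
    ContMDiffAt 𝓘(ℝ, ℂ) (𝓡 1) ∞ Complex.direction z := by
  have h1 : ContDiffAt ℝ ∞ (fun w : ℂ => (Complex.log (w / z)).im) z := by
    have h2 : ContDiffAt ℝ ∞ Complex.log (z / z) := by
      rw [div_self hz]
      exact (Complex.contDiffAt_log Complex.one_mem_slitPlane).restrict_scalars ℝ
    have h3 : ContDiffAt ℝ ∞ (fun w : ℂ => w / z) z := contDiffAt_id.div_const z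
    exact Complex.imCLM.contDiff.contDiffAt.comp z (h2.fun_comp (f := fun w : ℂ => w / z) z h3)
  have h4 : ContMDiffAt 𝓘(ℝ, ℂ) (𝓡 1) ∞
      (fun w : ℂ => z.direction * Circle.exp (Complex.log (w / z)).im) z :=
    contMDiffAt_const.mul (contMDiff_circleExp.contMDiffAt.comp z h1.contMDiffAt)
  refine h4.congr_of_eventuallyEq ?_
  filter_upwards [isOpen_ne.mem_nhds hz] with w hw
  rw [Complex.direction_eq_iff hw, Complex.log_im, Circle.coe_mul]
  have h5 : (‖z‖ : ℂ) ≠ 0 := by simpa using hz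
  have h6 := (w / z).norm_mul_direction
  rw [norm_div, Complex.ofReal_div] at h6
  calc w = (w / z) * z := (div_mul_cancel₀ w hz).symm
    _ = (‖w‖ / ‖z‖ * (w / z).direction) * (‖z‖ * z.direction) := by
      rw [h6, z.norm_mul_direction]
    _ = ‖w‖ * (z.direction * (w / z).direction) := by
      field_simp

/-- The radial extension to `T² × ℂ` of a self-map of `T² × S¹`. -/
def radialExtension (φ : TorusGluing) (x : Torus × ℂ) : Torus × ℂ :=
  ((φ (x.1, x.2.direction)).1, (‖x.2‖ : ℂ) * (φ (x.1, x.2.direction)).2)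

variable (φ : TorusGluing)

@[simp]
theorem norm_radialExtension_snd (x : Torus × ℂ) : ‖(radialExtension φ x).2‖ = ‖x.2‖ := by
  simp [radialExtension, Circle.norm_coe]

theorem radialExtension_snd_eq_zero {x : Torus × ℂ} : (radialExtension φ x).2 = 0 ↔ x.2 = 0 := by
  rw [← norm_eq_zero, norm_radialExtension_snd, norm_eq_zero]

theorem radialExtension_real_mul (t : Torus) {r : ℝ} (hr : 0 < r) (s : Circle) :
    radialExtension φ (t, r * s) = ((φ (t, s)).1, (r : ℂ) * (φ (t, s)).2) := by
  simp [radialExtension, Complex.direction_real_mul hr, abs_of_pos hr, Circle.norm_coe]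

/-- Points of the zero section have no direction, only a default one, so inverse maps and smoothness
are available off that section only. -/
theorem radialExtension_symm_apply {x : Torus × ℂ} (hx : x.2 ≠ 0) :
    radialExtension φ.symm (radialExtension φ x) = x := by
  conv_lhs => rw [radialExtension.eq_def φ]
  rw [radialExtension_real_mul _ _ (norm_pos_iff.2 hx)]
  simp

theorem radialExtension_apply_symm {x : Torus × ℂ} (hx : x.2 ≠ 0) :
    radialExtension φ (radialExtension φ.symm x) = x :=
  radialExtension_symm_apply φ.symm hx

theorem contMDiffAt_radialExtension {x : Torus × ℂ} (hx : x.2 ≠ 0) :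
    ContMDiffAt (torusModel.prod 𝓘(ℝ, ℂ)) (torusModel.prod 𝓘(ℝ, ℂ)) ∞ (radialExtension φ) x := by
  have h1 : ContMDiffAt (torusModel.prod 𝓘(ℝ, ℂ)) (torusModel.prod (𝓡 1)) ∞
      (fun x : Torus × ℂ => φ (x.1, x.2.direction)) x :=
    φ.contMDiff.contMDiffAt.comp x (contMDiffAt_fst.prodMk
      ((Complex.contMDiffAt_direction hx).comp x contMDiffAt_snd))
  have h2 : ContMDiffAt (torusModel.prod 𝓘(ℝ, ℂ)) 𝓘(ℝ, ℝ) ∞ (fun x : Torus × ℂ => ‖x.2‖) x :=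
    (contDiffAt_norm ℝ hx).contMDiffAt.comp x contMDiffAt_snd
  have h3 : ContMDiff (𝓡 1) 𝓘(ℝ, ℂ) ∞ (fun s : Circle => (s : ℂ)) := by
    have := finrank_real_complex_fact'
    exact contMDiff_coe_sphere
  have h4 := h2.smul (h3.contMDiffAt.comp x h1.snd)
  refine (h1.fst.prodMk h4).congr_of_eventuallyEq (Filter.Eventually.of_forall fun y => ?_)
  simp [radialExtension]

theorem continuousOn_radialExtension : ContinuousOn (radialExtension φ) {x | x.2 ≠ 0} :=
  fun _ hx => (contMDiffAt_radialExtension φ hx).continuousAt.continuousWithinAt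

theorem radialExtension_image (s : Set (Torus × ℂ)) :
    radialExtension φ '' (s ∩ {x | x.2 ≠ 0}) =
      {x | x.2 ≠ 0} ∩ radialExtension φ.symm ⁻¹' s := by
  ext x
  constructor
  · rintro ⟨y, ⟨hy, hy0⟩, rfl⟩
    refine ⟨mt (radialExtension_snd_eq_zero φ).1 hy0, ?_⟩
    rwa [mem_preimage, radialExtension_symm_apply φ hy0]
  · rintro ⟨hx0, hx⟩
    exact ⟨_, ⟨hx, mt (radialExtension_snd_eq_zero φ.symm).1 hx0⟩, radialExtension_apply_symm φ hx0⟩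

theorem isOpen_snd_ne_zero : IsOpen {x : Torus × ℂ | x.2 ≠ 0} :=
  isOpen_ne.preimage continuous_snd

theorem isOpen_radialExtension_image {s : Set (Torus × ℂ)} (hs : IsOpen s) :
    IsOpen (radialExtension φ '' (s ∩ {x | x.2 ≠ 0})) := by
  rw [radialExtension_image]
  exact (continuousOn_radialExtension φ.symm).isOpen_inter_preimage isOpen_snd_ne_zero hs

end Radial

/-! ### The ambient manifold as a filling of the exterior -/

section Exterior

variable {X : Type u} [TopologicalSpace X] [T2Space X] {ι : Type} [Finite ι]
  {F : ι → C(Torus × ℂ, X)}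

theorem mem_exterior_core {x : X} :
    x ∈ exterior (fun i => core (F i)) ↔ ∀ i t, F i (t, 0) ≠ x := by
  simp [exterior, core, ← SetLike.mem_coe]

/-- A family of disjoint tubular neighbourhoods `T² × ℂ`. -/
structure IsTubular {X : Type u} [TopologicalSpace X] {ι : Type} (F : ι → C(Torus × ℂ, X)) :
    Prop where
  isOpenEmbedding : ∀ i, IsOpenEmbedding (F i)
  disjoint : Pairwise fun i j => Disjoint (range (F i)) (range (F j))

theorem IsTubular.eq_iff {X : Type u} [TopologicalSpace X] {ι : Type} {F : ι → C(Torus × ℂ, X)}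
    (hF : IsTubular F) {i j : ι} {x y : Torus × ℂ} :
    F i x = F j y ↔ i = j ∧ x = y := by
  constructor
  · intro h
    by_cases hij : i = j
    · subst hij
      exact ⟨rfl, (hF.isOpenEmbedding i).injective h⟩
    · exact absurd h ((hF.disjoint hij).ne_of_mem ⟨x, rfl⟩ ⟨y, rfl⟩)
  · rintro ⟨rfl, rfl⟩
    rfl

theorem IsTubular.mem_exterior (hF : IsTubular F) {i : ι} {x : Torus × ℂ} :
    F i x ∈ exterior (fun i => core (F i)) ↔ x.2 ≠ 0 := by
  rw [mem_exterior_core]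
  constructor
  · intro h hx
    exact h i x.1 (by rw [← hx])
  · rintro hx j t h
    obtain ⟨-, h⟩ := hF.eq_iff.1 h
    exact hx (by rw [← h])

end Exterior

/-- A map out of a disjoint union of pieces `T² × ℂ` is an open embedding if its restrictions to the
pieces are and the images are disjoint. -/
theorem Topology.IsOpenEmbedding.of_discrete_torus {ι : Type} [TopologicalSpace ι]
    [DiscreteTopology ι] {Y : Type*} [TopologicalSpace Y] {f : (ι × Torus) × ℂ → Y}
    (hf : ∀ i, IsOpenEmbedding fun x : Torus × ℂ => f ((i, x.1), x.2))
    (hf' : ∀ i j (x y : Torus × ℂ), f ((i, x.1), x.2) = f ((j, y.1), y.2) → i = j) : IsOpenEmbedding f := by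
  have h : IsOpenEmbedding (f ∘ (Homeomorph.prodAssoc ι Torus ℂ).symm) := by
    refine .of_continuous_injective_isOpenMap
      (continuous_prod_of_discrete_left.2 fun i => (hf i).continuous) ?_
      (isOpenMap_prod_of_discrete_left.2 fun i => (hf i).isOpenMap)
    rintro ⟨i, x⟩ ⟨j, y⟩ h
    obtain rfl := hf' i j x y h
    exact congrArg (Prod.mk i) ((hf i).injective h)
  convert! h.comp (Homeomorph.prodAssoc ι Torus ℂ).isOpenEmbedding using 1

namespace IsTubular

variable {X : Type u} [TopologicalSpace X] [T2Space X] {ι : Type} [Finite ι]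
  {F : ι → C(Torus × ℂ, X)}

section Discrete

variable [TopologicalSpace ι] [DiscreteTopology ι]

/-- The union of the maps `F i`. -/
def tube (F : ι → C(Torus × ℂ, X)) : C((ι × Torus) × ℂ, X) :=
  ⟨(fun x : ι × (Torus × ℂ) => F x.1 x.2) ∘ Homeomorph.prodAssoc ι Torus ℂ,
    (continuous_prod_of_discrete_left.2 fun i => (F i).continuous).comp (Homeomorph.continuous _)⟩

/-- The inclusion of the complement of the cores. -/
def exteriorInclusion (F : ι → C(Torus × ℂ, X)) : C(exterior fun i => core (F i), X) :=
  ⟨Subtype.val, continuous_subtype_val⟩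

/-- The union of the maps `F i`, on the complement of the cores. -/
def puncturedTube (hF : IsTubular F) :
    C((ι × Torus) × PuncturedPlane, exterior fun i => core (F i)) :=
  ⟨fun x => ⟨tube F (x.1, x.2), hF.mem_exterior.2 x.2.2⟩, by fun_prop⟩

theorem isFilling (hF : IsTubular F) :
    IsFilling (exteriorInclusion F) (tube F) hF.puncturedTube where
  left := (exterior fun i => core (F i)).isOpen.isOpenEmbedding_subtypeVal
  right := .of_discrete_torus hF.isOpenEmbedding fun _ _ _ _ h => (hF.eq_iff.1 h).1
  cover y := by
    by_cases hy : y ∈ exterior fun i => core (F i)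
    · exact .inl ⟨⟨y, hy⟩, rfl⟩
    · rw [mem_exterior_core] at hy
      push Not at hy
      obtain ⟨i, t, rfl⟩ := hy
      exact .inr ⟨((i, t), 0), rfl⟩
  comm _ _ := rfl
  core := by
    rintro ⟨i, t⟩ ⟨y, hy⟩
    exact mem_exterior_core.1 y.2 i t hy.symm

end Discrete

end IsTubular

/-! ### The surgered space as a filling of the same exterior -/

namespace TorusSurgery

variable {X : Type u} [TopologicalSpace X] [T2Space X] {ι : Type} [Finite ι]
  {F : ι → C(Torus × ℂ, X)} {φ : ι → TorusGluing}

/-- In polar coordinates the generating relation is the graph of the radial extension, off the zero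
section. -/
theorem surgeryRel_iff {a b : ↥(exterior fun i => core (F i)) ⊕ (Σ _ : ι, Torus × ℂ)} :
    SurgeryRel F φ a b ↔ ∃ i x y, x.2 ≠ 0 ∧ a = Sum.inr ⟨i, x⟩ ∧ b = Sum.inl y ∧
      (y : X) = F i (radialExtension (φ i) x) := by
  constructor
  · rintro ⟨i, t, s, r, hr, y, hy⟩
    exact ⟨i, _, y, mul_ne_zero (Complex.ofReal_ne_zero.2 hr.ne') s.coe_ne_zero, rfl, rfl,
      by rw [hy, radialExtension_real_mul _ _ hr]⟩
  · rintro ⟨i, ⟨t, z⟩, y, hx, rfl, rfl, hy⟩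
    have := SurgeryRel.glue (φ := φ) i t z.direction ‖z‖ (norm_pos_iff.2 hx) y hy
    rwa [z.norm_mul_direction] at this

theorem inr_eq_inl {i : ι} {x : Torus × ℂ} (hx : x.2 ≠ 0) {y : exterior fun i => core (F i)}
    (hy : (y : X) = F i (radialExtension (φ i) x)) : inr F φ i x = inl F φ y :=
  Quot.sound (surgeryRel_iff.2 ⟨i, x, y, hx, rfl, rfl, hy⟩)

open Classical in
/-- A normal form for the points of the surgered space: points of the complement of the tori, and
points of the new cores. -/
def normalForm (F : ι → C(Torus × ℂ, X)) (φ : ι → TorusGluing) :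
    TorusSurgery F φ → X ⊕ (ι × Torus) :=
  Quot.lift (Sum.elim (fun y => .inl y) fun x =>
    if x.2.2 = 0 then .inr (x.1, x.2.1) else .inl (F x.1 (radialExtension (φ x.1) x.2))) <| by
    intro a b h
    obtain ⟨i, x, y, hx, rfl, rfl, hy⟩ := surgeryRel_iff.1 h
    simp [hx, hy]

theorem normalForm_inl (y : exterior fun i => core (F i)) :
    normalForm F φ (inl F φ y) = .inl (y : X) := rfl

theorem normalForm_inr (i : ι) {x : Torus × ℂ} (hx : x.2 ≠ 0) :
    normalForm F φ (inr F φ i x) = .inl (F i (radialExtension (φ i) x)) :=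
  if_neg hx

theorem normalForm_inr_zero (i : ι) {x : Torus × ℂ} (hx : x.2 = 0) :
    normalForm F φ (inr F φ i x) = .inr (i, x.1) :=
  if_pos hx

theorem inl_injective : Function.Injective (inl F φ) := fun y y' h => by
  have := congrArg (normalForm F φ) h
  rw [normalForm_inl, normalForm_inl] at this
  exact Subtype.ext (Sum.inl_injective this)

/-- Equalities in the quotient are detected by `normalForm`, which avoids any analysis of the
equivalence relation generated by `SurgeryRel`. -/
theorem inl_eq_inr_iff {i : ι} {x : Torus × ℂ} {y : exterior fun i => core (F i)} :
    inl F φ y = inr F φ i x ↔ x.2 ≠ 0 ∧ (y : X) = F i (radialExtension (φ i) x) := by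
  constructor
  · intro h
    have := congrArg (normalForm F φ) h
    rw [normalForm_inl] at this
    by_cases hx : x.2 = 0
    · rw [normalForm_inr_zero i hx] at this
      exact absurd this Sum.inl_ne_inr
    · rw [normalForm_inr i hx] at this
      exact ⟨hx, Sum.inl_injective this⟩
  · rintro ⟨hx, hy⟩
    exact (inr_eq_inl hx hy).symm

theorem inr_eq_inr_iff (hF : IsTubular F) {i j : ι} {x y : Torus × ℂ} :
    inr F φ i x = inr F φ j y ↔ i = j ∧ x = y := by
  constructor
  · intro h
    have := congrArg (normalForm F φ) h
    by_cases hx : x.2 = 0 <;> by_cases hy : y.2 = 0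
    · rw [normalForm_inr_zero i hx, normalForm_inr_zero j hy] at this
      have h' := Sum.inr_injective this
      exact ⟨congrArg Prod.fst h', Prod.ext (congrArg Prod.snd h') (hx.trans hy.symm)⟩
    · rw [normalForm_inr_zero i hx, normalForm_inr j hy] at this
      exact absurd this Sum.inr_ne_inl
    · rw [normalForm_inr i hx, normalForm_inr_zero j hy] at this
      exact absurd this Sum.inl_ne_inr
    · rw [normalForm_inr i hx, normalForm_inr j hy] at this
      obtain ⟨rfl, h'⟩ := hF.eq_iff.1 (Sum.inl_injective this)
      refine ⟨rfl, ?_⟩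
      rw [← radialExtension_symm_apply (φ i) hx, h', radialExtension_symm_apply (φ i) hy]
  · rintro ⟨rfl, rfl⟩
    rfl

theorem isOpen_iff {s : Set (TorusSurgery F φ)} :
    IsOpen s ↔ IsOpen (inl F φ ⁻¹' s) ∧ ∀ i, IsOpen (inr F φ i ⁻¹' s) := by
  have h : IsOpen s ↔ IsOpen ((Quot.mk (SurgeryRel F φ)) ⁻¹' s) :=
    isQuotientMap_quot_mk.isOpen_preimage.symm
  rw [h, isOpen_sum_iff, isOpen_sigma_iff]
  rfl

theorem continuous_inl : Continuous (inl F φ) :=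
  continuous_def.2 fun _ hs => (isOpen_iff.1 hs).1

theorem continuous_inr (i : ι) : Continuous (inr F φ i) :=
  continuous_def.2 fun _ hs => (isOpen_iff.1 hs).2 i

theorem isOpenEmbedding_inl (hF : IsTubular F) : IsOpenEmbedding (inl F φ) := by
  refine .of_continuous_injective_isOpenMap continuous_inl inl_injective fun U hU => ?_
  refine isOpen_iff.2 ⟨by rwa [inl_injective.preimage_image], fun i => ?_⟩
  obtain ⟨V, hV, rfl⟩ := isOpen_induced_iff.1 hU
  have h : inr F φ i ⁻¹' (inl F φ '' (Subtype.val ⁻¹' V)) =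
      {x | x.2 ≠ 0} ∩ (fun x => F i (radialExtension (φ i) x)) ⁻¹' V := by
    ext x
    constructor
    · rintro ⟨y, hy, hxy⟩
      obtain ⟨hx, h⟩ := inl_eq_inr_iff.1 hxy
      exact ⟨hx, by rw [mem_preimage, ← h]; exact hy⟩
    · rintro ⟨hx, hV⟩
      exact ⟨⟨_, hF.mem_exterior.2 (mt (radialExtension_snd_eq_zero (φ i)).1 hx)⟩, hV,
        (inr_eq_inl hx rfl).symm⟩
  rw [h]
  exact ((F i).continuous.comp_continuousOn
    (continuousOn_radialExtension (φ i))).isOpen_inter_preimage isOpen_snd_ne_zero hV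

/-- The trace of an open set on the exterior is its image under the gluing map. That image is open
because the radial extension has a continuous inverse off the zero section. -/
theorem isOpenEmbedding_inr (hF : IsTubular F) (i : ι) : IsOpenEmbedding (inr F φ i) := by
  refine .of_continuous_injective_isOpenMap (continuous_inr i)
    (fun x y h => ((inr_eq_inr_iff hF).1 h).2) fun U hU => ?_
  refine isOpen_iff.2 ⟨?_, fun j => ?_⟩
  · have h : inl F φ ⁻¹' (inr F φ i '' U) =
        Subtype.val ⁻¹' (F i '' (radialExtension (φ i) '' (U ∩ {x | x.2 ≠ 0}))) := by
      ext y
      constructor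
      · rintro ⟨x, hx, hxy⟩
        obtain ⟨hx', h⟩ := inl_eq_inr_iff.1 hxy.symm
        exact ⟨_, ⟨x, ⟨hx, hx'⟩, rfl⟩, h.symm⟩
      · rintro ⟨_, ⟨x, ⟨hx, hx'⟩, rfl⟩, h⟩
        exact ⟨x, hx, inr_eq_inl hx' h.symm⟩
    rw [h]
    exact ((hF.isOpenEmbedding i).isOpenMap _
      (isOpen_radialExtension_image (φ i) hU)).preimage continuous_subtype_val
  · by_cases hij : j = i
    · subst hij
      rwa [preimage_image_eq _ fun x y h => ((inr_eq_inr_iff hF).1 h).2]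
    · convert! isOpen_empty
      rw [eq_empty_iff_forall_notMem]
      rintro x ⟨y, -, h⟩
      exact hij ((inr_eq_inr_iff hF).1 h).1.symm

section Discrete

variable [TopologicalSpace ι] [DiscreteTopology ι]

/-- The union of the new pieces. -/
def newTube (F : ι → C(Torus × ℂ, X)) (φ : ι → TorusGluing) :
    C((ι × Torus) × ℂ, TorusSurgery F φ) :=
  ⟨(fun x : ι × (Torus × ℂ) => inr F φ x.1 x.2) ∘ Homeomorph.prodAssoc ι Torus ℂ,
    (continuous_prod_of_discrete_left.2 fun i => continuous_inr i).comp (Homeomorph.continuous _)⟩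

/-- The gluing map of the new pieces. -/
def gluing (hF : IsTubular F) (φ : ι → TorusGluing) :
    C((ι × Torus) × PuncturedPlane, exterior fun i => core (F i)) where
  toFun x := ⟨F x.1.1 (radialExtension (φ x.1.1) (x.1.2, x.2)),
    hF.mem_exterior.2 (mt (radialExtension_snd_eq_zero _).1 x.2.2)⟩
  continuous_toFun := by
    refine Continuous.subtype_mk ?_ _
    have h : Continuous fun x : ι × (Torus × PuncturedPlane) =>
        F x.1 (radialExtension (φ x.1) (x.2.1, x.2.2)) :=
      continuous_prod_of_discrete_left.2 fun i => (F i).continuous.comp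
        ((continuousOn_radialExtension (φ i)).comp_continuous (by fun_prop) fun x => x.2.2)
    exact h.comp (Homeomorph.prodAssoc ι Torus PuncturedPlane).continuous

theorem coe_gluing (hF : IsTubular F) (i : ι) (t : Torus) (z : PuncturedPlane) :
    (gluing hF φ ((i, t), z) : X) = F i (radialExtension (φ i) (t, z)) := rfl

theorem isFilling (hF : IsTubular F) (φ : ι → TorusGluing) :
    IsFilling (⟨inl F φ, continuous_inl⟩ : C(exterior fun i => core (F i), TorusSurgery F φ))
      (newTube F φ) (gluing hF φ) where
  left := isOpenEmbedding_inl hF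
  right := .of_discrete_torus (isOpenEmbedding_inr hF)
    fun _ _ _ _ h => ((inr_eq_inr_iff hF).1 h).1
  cover := by
    rintro ⟨y | ⟨i, x⟩⟩
    · exact .inl ⟨y, rfl⟩
    · exact .inr ⟨((i, x.1), x.2), rfl⟩
  comm := fun ⟨i, t⟩ z => (inr_eq_inl (x := (t, (z : ℂ))) z.2 rfl).symm
  core := by
    rintro ⟨i, t⟩ ⟨y, hy⟩
    exact (inl_eq_inr_iff.1 hy).1 rfl

/-- Radial extensions preserve the norm of the fibre coordinate, so this set is the trace on the
exterior of the compact tubes `F i (T² × D²)`. -/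
theorem isClosed_gluing_image (hF : IsTubular F) :
    IsClosed (gluing hF φ '' {x | ‖(x.2 : ℂ)‖ ≤ 1}) := by
  have h : gluing hF φ '' {x | ‖(x.2 : ℂ)‖ ≤ 1} =
      Subtype.val ⁻¹' ⋃ i, F i '' (univ ×ˢ Metric.closedBall 0 1) := by
    ext y
    simp only [mem_preimage, mem_iUnion]
    constructor
    · rintro ⟨⟨⟨i, t⟩, z⟩, hz, rfl⟩
      exact ⟨i, _, ⟨mem_univ _, by simpa using hz⟩, rfl⟩
    · rintro ⟨i, x, ⟨-, hx⟩, hxy⟩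
      have hx0 : x.2 ≠ 0 := hF.mem_exterior.1 (hxy ▸ y.2)
      refine ⟨((i, (radialExtension (φ i).symm x).1), ⟨(radialExtension (φ i).symm x).2,
        mt (radialExtension_snd_eq_zero _).1 hx0⟩), by simpa using hx, Subtype.ext ?_⟩
      rw [coe_gluing, ← hxy]
      exact congrArg (F i) (radialExtension_apply_symm (φ i) hx0)
  rw [h]
  exact (isClosed_iUnion_of_finite fun i => ((isCompact_univ.prod
    (isCompact_closedBall 0 1)).image (F i).continuous).isClosed).preimage continuous_subtype_val

theorem t2Space (hF : IsTubular F) : T2Space (TorusSurgery F φ) :=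
  (isFilling hF φ).t2Space (isClosed_gluing_image hF)

theorem secondCountableTopology [SecondCountableTopology X] (hF : IsTubular F) :
    SecondCountableTopology (TorusSurgery F φ) :=
  (isFilling hF φ).secondCountableTopology

end Discrete

end TorusSurgery

/-! ### The smooth structure of the surgered space -/

namespace Topology.IsOpenEmbedding

variable {A B C : Type*} [TopologicalSpace A] [TopologicalSpace B] [TopologicalSpace C] [Nonempty A]
  {f : A → B} {g : A → C}

/-- The partial homeomorphism `f a ↦ g a` defined by two open embeddings. -/
def openPartialHomeomorph (hf : IsOpenEmbedding f) (hg : IsOpenEmbedding g) :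
    OpenPartialHomeomorph B C :=
  (hf.toOpenPartialHomeomorph f).symm ≫ₕ hg.toOpenPartialHomeomorph g

theorem openPartialHomeomorph_source (hf : IsOpenEmbedding f) (hg : IsOpenEmbedding g) :
    (hf.openPartialHomeomorph hg).source = range f := by
  simp [openPartialHomeomorph]

theorem openPartialHomeomorph_target (hf : IsOpenEmbedding f) (hg : IsOpenEmbedding g) :
    (hf.openPartialHomeomorph hg).target = range g := by
  simp [openPartialHomeomorph]

theorem openPartialHomeomorph_apply (hf : IsOpenEmbedding f) (hg : IsOpenEmbedding g) (a : A) :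
    hf.openPartialHomeomorph hg (f a) = g a := by
  simp [openPartialHomeomorph, hf.toOpenPartialHomeomorph_left_inv]

theorem openPartialHomeomorph_symm_apply (hf : IsOpenEmbedding f) (hg : IsOpenEmbedding g) (a : A) :
    (hf.openPartialHomeomorph hg).symm (g a) = f a := by
  simp [openPartialHomeomorph, hg.toOpenPartialHomeomorph_left_inv]

end Topology.IsOpenEmbedding

theorem IsLocalDiffeomorph.contMDiffAt_toOpenPartialHomeomorph_symm {E E' H H' M M' : Type*}
    [NormedAddCommGroup E] [NormedSpace ℝ E] [NormedAddCommGroup E'] [NormedSpace ℝ E']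
    [TopologicalSpace H] [TopologicalSpace H'] {J : ModelWithCorners ℝ E H}
    {J' : ModelWithCorners ℝ E' H'} [TopologicalSpace M] [ChartedSpace H M]
    [TopologicalSpace M'] [ChartedSpace H' M'] [Nonempty M] {f : M → M'}
    (hf : IsLocalDiffeomorph J J' ∞ f) (hf' : IsOpenEmbedding f) (x : M) :
    ContMDiffAt J' J ∞ (hf'.toOpenPartialHomeomorph f).symm (f x) := by
  refine (hf x).localInverse_contMDiffAt.congr_of_eventuallyEq ?_
  filter_upwards [(hf x).localInverse_open_source.mem_nhds (hf x).localInverse_mem_source] with y hy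
  conv_lhs => rw [← (hf x).localInverse_right_inv hy]
  exact hf'.toOpenPartialHomeomorph_left_inv

namespace TorusSurgery

theorem contMDiffAt_conj {X : Type u} [TopologicalSpace X]
    [ChartedSpace (EuclideanSpace ℝ (Fin 4)) X] {ι : Type} {F : ι → C(Torus × ℂ, X)} (hF : IsTubular F)
    (hF' : ∀ i, IsLocalDiffeomorph (torusModel.prod 𝓘(ℝ, ℂ)) (𝓡 4) ∞ (F i)) (i : ι)
    (ψ : TorusGluing) {x : Torus × ℂ} (hx : x.2 ≠ 0) :
    ContMDiffAt (𝓡 4) (𝓡 4) ∞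
      (fun y => F i (radialExtension ψ (((hF.isOpenEmbedding i).toOpenPartialHomeomorph _).symm y)))
      (F i x) := by
  have h1 := (hF' i).contMDiffAt_toOpenPartialHomeomorph_symm (hF.isOpenEmbedding i) x
  have h2 := contMDiffAt_radialExtension ψ hx
  rw [← (hF.isOpenEmbedding i).toOpenPartialHomeomorph_left_inv (x := x)] at h2
  exact (hF' i).contMDiff.contMDiffAt.comp _ (h2.comp _ h1)

/-- The smooth structure of the surgered space. -/
theorem exists_chartedSpace {X : Type u} [TopologicalSpace X] [T2Space X]
    [ChartedSpace (EuclideanSpace ℝ (Fin 4)) X] [IsManifold (𝓡 4) ∞ X] {ι : Type} [Finite ι]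
    [Nonempty ι] {F : ι → C(Torus × ℂ, X)} {φ : ι → TorusGluing} (hF : IsTubular F)
    (hF' : ∀ i, IsLocalDiffeomorph (torusModel.prod 𝓘(ℝ, ℂ)) (𝓡 4) ∞ (F i)) :
    ∃ _ : ChartedSpace (EuclideanSpace ℝ (Fin 4)) (TorusSurgery F φ),
      IsManifold (𝓡 4) ∞ (TorusSurgery F φ) ∧
      IsLocalDiffeomorph (𝓡 4) (𝓡 4) ∞ (inl F φ) ∧
      ∀ i, IsLocalDiffeomorph (torusModel.prod 𝓘(ℝ, ℂ)) (𝓡 4) ∞ (inr F φ i) := by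
  obtain ⟨i₀⟩ := ‹Nonempty ι›
  have : Nonempty (exterior fun i => core (F i)) :=
    ⟨⟨F i₀ (1, 1), hF.mem_exterior.2 one_ne_zero⟩⟩
  have hval := (exterior fun i => core (F i)).isOpen.isOpenEmbedding_subtypeVal
  -- Each new piece is parametrized by the old tube `F i (T² × ℂ)`, so that all pieces are open
  -- subsets of the one manifold `X`. Nontrivial transition maps are then radial extensions
  -- conjugated by `F i`.
  let e : Option ι → OpenPartialHomeomorph X (TorusSurgery F φ) := fun k =>
    k.elim (hval.openPartialHomeomorph (isOpenEmbedding_inl hF))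
      fun i => (hF.isOpenEmbedding i).openPartialHomeomorph (isOpenEmbedding_inr hF i)
  have hnone (y : exterior fun i => core (F i)) : e none y = inl F φ y :=
    hval.openPartialHomeomorph_apply (isOpenEmbedding_inl hF) y
  have hsome (i : ι) (x : Torus × ℂ) : e (some i) (F i x) = inr F φ i x :=
    (hF.isOpenEmbedding i).openPartialHomeomorph_apply (isOpenEmbedding_inr hF i) x
  have hnone' (y : exterior fun i => core (F i)) : (e none).symm (inl F φ y) = y :=
    hval.openPartialHomeomorph_symm_apply (isOpenEmbedding_inl hF) y
  have hsome' (i : ι) (x : Torus × ℂ) : (e (some i)).symm (inr F φ i x) = F i x :=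
    (hF.isOpenEmbedding i).openPartialHomeomorph_symm_apply (isOpenEmbedding_inr hF i) x
  have hsn : (e none).source = range Subtype.val :=
    hval.openPartialHomeomorph_source (isOpenEmbedding_inl hF)
  have htn : (e none).target = range (inl F φ) :=
    hval.openPartialHomeomorph_target (isOpenEmbedding_inl hF)
  have hss (i : ι) : (e (some i)).source = range (F i) :=
    (hF.isOpenEmbedding i).openPartialHomeomorph_source (isOpenEmbedding_inr hF i)
  have hts (i : ι) : (e (some i)).target = range (inr F φ i) :=
    (hF.isOpenEmbedding i).openPartialHomeomorph_target (isOpenEmbedding_inr hF i)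
  have hinv (i : ι) (x : Torus × ℂ) :
      ((hF.isOpenEmbedding i).toOpenPartialHomeomorph _).symm (F i x) = x :=
    (hF.isOpenEmbedding i).toOpenPartialHomeomorph_left_inv
  obtain ⟨C, hC, he⟩ := exists_chartedSpace_of_openPartialHomeomorph (J := 𝓡 4) e (by
      rintro ⟨y | ⟨i, x⟩⟩
      · exact ⟨none, htn ▸ ⟨y, rfl⟩⟩
      · exact ⟨some i, hts i ▸ ⟨x, rfl⟩⟩) (by
    rintro (_ | i) (_ | j)
    · refine contMDiffOn_id.congr fun x hx => ?_
      rw [OpenPartialHomeomorph.trans_source, hsn] at hx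
      obtain ⟨⟨y, rfl⟩, -⟩ := hx
      rw [OpenPartialHomeomorph.coe_trans, Function.comp_apply, hnone, hnone', id]
    · have key : ∀ x ∈ (e none ≫ₕ (e (some j)).symm).source, ∃ b : Torus × ℂ, b.2 ≠ 0 ∧
          x = F j (radialExtension (φ j) b) ∧ (e none ≫ₕ (e (some j)).symm) x = F j b := by
        intro x hx
        rw [OpenPartialHomeomorph.trans_source, hsn] at hx
        obtain ⟨⟨y, rfl⟩, hy⟩ := hx
        rw [OpenPartialHomeomorph.symm_source, hts, mem_preimage, hnone] at hy
        obtain ⟨b, hb⟩ := hy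
        obtain ⟨hb0, hyb⟩ := inl_eq_inr_iff.1 hb.symm
        exact ⟨b, hb0, hyb, by
          rw [OpenPartialHomeomorph.coe_trans, Function.comp_apply, hnone, ← hb, hsome']⟩
      have hcongr : EqOn (e none ≫ₕ (e (some j)).symm) _ _ := fun x hx => by
        obtain ⟨b, hb, hxb, hx'⟩ := key x hx
        show _ = F j (radialExtension (φ j).symm
          (((hF.isOpenEmbedding j).toOpenPartialHomeomorph _).symm x))
        rw [hx', hxb, hinv, radialExtension_symm_apply _ hb]
      refine ContMDiffOn.congr (fun x hx => ?_) hcongr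
      obtain ⟨b, hb, rfl, -⟩ := key x hx
      exact (contMDiffAt_conj hF hF' j _
        (mt (radialExtension_snd_eq_zero _).1 hb)).contMDiffWithinAt
    · have key : ∀ x ∈ (e (some i) ≫ₕ (e none).symm).source, ∃ b : Torus × ℂ, b.2 ≠ 0 ∧
          x = F i b ∧ (e (some i) ≫ₕ (e none).symm) x = F i (radialExtension (φ i) b) := by
        intro x hx
        rw [OpenPartialHomeomorph.trans_source, hss] at hx
        obtain ⟨⟨b, rfl⟩, hb⟩ := hx
        rw [OpenPartialHomeomorph.symm_source, htn, mem_preimage, hsome] at hb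
        obtain ⟨y, hy⟩ := hb
        obtain ⟨hb0, hyb⟩ := inl_eq_inr_iff.1 hy
        exact ⟨b, hb0, rfl, by
          rw [OpenPartialHomeomorph.coe_trans, Function.comp_apply, hsome, ← hy, hnone', hyb]⟩
      have hcongr : EqOn (e (some i) ≫ₕ (e none).symm) _ _ := fun x hx => by
        obtain ⟨b, hb, hxb, hx'⟩ := key x hx
        show _ = F i (radialExtension (φ i)
          (((hF.isOpenEmbedding i).toOpenPartialHomeomorph _).symm x))
        rw [hx', hxb, hinv]
      refine ContMDiffOn.congr (fun x hx => ?_) hcongr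
      obtain ⟨b, hb, rfl, -⟩ := key x hx
      exact (contMDiffAt_conj hF hF' i _ hb).contMDiffWithinAt
    · refine contMDiffOn_id.congr fun x hx => ?_
      rw [OpenPartialHomeomorph.trans_source, hss] at hx
      obtain ⟨⟨b, rfl⟩, hb⟩ := hx
      rw [OpenPartialHomeomorph.symm_source, hts, mem_preimage, hsome] at hb
      obtain ⟨b', hb'⟩ := hb
      obtain ⟨rfl, rfl⟩ := (inr_eq_inr_iff hF).1 hb'
      rw [OpenPartialHomeomorph.coe_trans, Function.comp_apply, hsome, hsome', id])
  refine ⟨C, hC, fun y => ?_, fun i x => ?_⟩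
  · have h := (TopologicalSpace.Opens.isLocalDiffeomorph_val (J := 𝓡 4) _ y).comp (𝓡 4) (TorusSurgery F φ)
      (he none y (hsn ▸ ⟨y, rfl⟩))
    convert! h using 1
    exact funext fun y => (hnone y).symm
  · have h := (hF' i x).comp (𝓡 4) (TorusSurgery F φ) (he (some i) (F i x) (hss i ▸ ⟨x, rfl⟩))
    convert! h using 1
    exact funext fun x => (hsome i x).symm

end TorusSurgery

/-! ### The fundamental group of a filling -/

namespace PathHom

variable {X Y H : Type*} [TopologicalSpace X] [TopologicalSpace Y] [Group H]

/-- A path homomorphism is surjective if it is surjective on all fundamental groups. -/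
def IsSurjective (Φ : PathHom Y H) : Prop :=
  ∀ (y : Y) (h : H), ∃ p : Path y y, Φ p.toContinuousMap = h

theorem isSurjective_of_toMonoidHom [PathConnectedSpace Y] (Φ : PathHom Y H) {x : Y}
    (hΦ : Function.Surjective (Φ.toMonoidHom x)) : Φ.IsSurjective := by
  intro y h
  let c := PathConnectedSpace.somePath y x
  obtain ⟨q, hq⟩ := hΦ (Φ c.toContinuousMap * h * (Φ c.toContinuousMap)⁻¹)
  induction q using Path.Homotopic.Quotient.ind with | mk q =>
  rw [toMonoidHom_mk] at hq
  refine ⟨c.trans (q.trans c.symm), ?_⟩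
  rw [Φ.map_trans, Φ.map_trans, Φ.map_symm, hq]
  group

theorem IsSurjective.comp {H' : Type*} [Group H'] {Φ : PathHom Y H} (hΦ : Φ.IsSurjective)
    {f : H →* H'} (hf : Function.Surjective f) : (Φ.comp f).IsSurjective := by
  intro y h
  obtain ⟨h, rfl⟩ := hf h
  obtain ⟨p, rfl⟩ := hΦ y h
  exact ⟨p, rfl⟩

theorem IsFaithful.comp {H' : Type*} [Group H'] {Φ : PathHom Y H} (hΦ : Φ.IsFaithful)
    {f : H →* H'} (hf : Function.Injective f) : (Φ.comp f).IsFaithful :=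
  fun p hp => hΦ p (hf (hp.trans (map_one f).symm))

theorem exists_isFaithful (Y : Type*) [TopologicalSpace Y] [PathConnectedSpace Y] (y : Y) :
    ∃ Φ : PathHom Y (FundamentalGroup Y y), Φ.IsFaithful :=
  ⟨ofMonoidHom (.id _) fun z => PathConnectedSpace.somePath y z,
    ofMonoidHom_isFaithful _ Function.injective_id⟩

/-- A closed curve as an element of the fundamental group. -/
def loopClass (c : C(Circle, Y)) {y : Y} (h : c 1 = y) : FundamentalGroup Y y :=
  Path.Homotopic.Quotient.mk ((loopPath c).cast h.symm h.symm)

theorem toMonoidHom_loopClass (Φ : PathHom Y H) (c : C(Circle, Y)) {y : Y} (h : c 1 = y) :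
    Φ.toMonoidHom y (loopClass c h) = Φ.loop c := rfl

theorem map_loopClass (f : C(X, Y)) (c : C(Circle, X)) {x : X} (h : c 1 = x) :
    FundamentalGroup.map f x (loopClass c h) = loopClass (f.comp c) (congrArg f h) := rfl

end PathHom

namespace IsFilling

variable {A P Y : Type*} [TopologicalSpace A] [TopologicalSpace P] [TopologicalSpace Y]
  {j : C(A, Y)} {k : C(P × ℂ, Y)} {e : C(P × PuncturedPlane, A)}

theorem nullhomotopic_fibreCircle (h : IsFilling j k e) (t : P) :
    (j.comp (fibreCircle e t)).Nullhomotopic := by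
  let c : C(Circle, ℂ) := ⟨fun s => s, by fun_prop⟩
  have : j.comp (fibreCircle e t) = (k.comp ((ContinuousMap.const ℂ t).prodMk (.id ℂ))).comp c := by
    ext s
    exact h.comm t _
  rw [this, ← ContinuousMap.id_comp c]
  exact ((id_nullhomotopic ℂ).comp_left c).comp_right _

/-- If the boundary circles of the fibres are contractible, filling does not change
the fundamental group. -/
theorem isFaithful_comap {H : Type*} [Group H] (h : IsFilling j k e) [PathConnectedSpace A]
    (he : ∀ t, (fibreCircle e t).Nullhomotopic) {ψ : PathHom Y H} (hψ : ψ.IsFaithful) :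
    (ψ.comap j).IsFaithful := by
  intro u p hp
  obtain ⟨χ, hχ⟩ := PathHom.exists_isFaithful A u
  -- A faithful `χ` on `A` extends over `Y` up to conjugation, so a loop that dies in `Y` already
  -- dies in `A`.
  obtain ⟨Φ, g, hΦ⟩ := h.exists_pathHom χ fun t => χ.loop_eq_one_of_nullhomotopic (he t)
  refine hχ.gauge g p ?_
  rw [← hΦ]
  exact (Φ.map_homotopic (hψ (p.map j.continuous) hp)).trans (Φ.map_refl _)

theorem isSurjective_comap {H : Type*} [Group H] (h : IsFilling j k e)
    {ψ : PathHom Y H} (hψ : ψ.IsSurjective) : (ψ.comap j).IsSurjective := by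
  intro u x
  obtain ⟨p, rfl⟩ := hψ (j u) x
  obtain ⟨α, hα⟩ := h.exists_path_map_homotopic p
  exact ⟨α, (ψ.map_homotopic hα).symm⟩

/-- The fundamental group of a filling is the quotient by the classes of the boundary circles. -/
theorem nonempty_fundamentalGroup_mulEquiv {H Q : Type*} [CommGroup H] [CommGroup Q]
    (h : IsFilling j k e) [PathConnectedSpace A] {ψ : PathHom A H} (hψ : ψ.IsFaithful)
    (hψ' : ψ.IsSurjective) {q : H →* Q} (hq : Function.Surjective q)
    (hker : q.ker = Subgroup.closure (range fun t => ψ.loop (fibreCircle e t))) (y : Y) :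
    Nonempty (FundamentalGroup Y y ≃* Q) := by
  have := h.pathConnectedSpace
  obtain ⟨u⟩ := PathConnectedSpace.nonempty (X := A)
  obtain ⟨Φ, g, hΦ⟩ := h.exists_pathHom (ψ.comp q) fun t => by
    have : ψ.loop (fibreCircle e t) ∈ q.ker := hker ▸ Subgroup.subset_closure ⟨t, rfl⟩
    exact this
  have hΦ' (α : Path u u) : Φ (j.comp α.toContinuousMap) = q (ψ α.toContinuousMap) := by
    rw [hΦ, PathHom.gauge_apply, PathHom.comp_apply]
    simp [mul_comm (g u)]
  obtain ⟨Ψ, hΨ⟩ := PathHom.exists_isFaithful Y (j u)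
  -- Every element of the kernel is the value of a loop in `A` that dies in `Y`: generators are
  -- boundary circles, joined to `u` by a path that commutativity of `H` makes irrelevant.
  have hkill : ∀ x ∈ q.ker, ∃ α : Path u u, ψ α.toContinuousMap = x ∧ Ψ (j.comp α.toContinuousMap) = 1 := by
    intro x hx
    rw [hker] at hx
    induction hx using Subgroup.closure_induction with
    | mem x hx =>
      obtain ⟨t, rfl⟩ := hx
      let c := PathConnectedSpace.somePath u (fibreCircle e t 1)
      refine ⟨c.trans ((loopPath (fibreCircle e t)).trans c.symm), ?_, ?_⟩
      · rw [ψ.map_trans, ψ.map_trans, ψ.map_symm, ψ.apply_loopPath, mul_comm, mul_inv_cancel_left]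
      · have h1 := Ψ.loop_eq_one_of_nullhomotopic (h.nullhomotopic_fibreCircle t)
        rw [← PathHom.comap_apply, PathHom.map_trans, PathHom.map_trans, PathHom.map_symm,
          PathHom.apply_loopPath, PathHom.loop_comap, h1, mul_one, inv_mul_cancel]
    | one => exact ⟨Path.refl u, ψ.map_refl u, (Ψ.comap j).map_refl u⟩
    | mul x y _ _ hx hy =>
      obtain ⟨α, rfl, hα⟩ := hx
      obtain ⟨β, rfl, hβ⟩ := hy
      refine ⟨β.trans α, ψ.map_trans _ _, ?_⟩
      rw [← PathHom.comap_apply, PathHom.map_trans, PathHom.comap_apply, PathHom.comap_apply, hα, hβ,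
        mul_one]
    | inv x _ hx =>
      obtain ⟨α, rfl, hα⟩ := hx
      refine ⟨α.symm, ψ.map_symm _, ?_⟩
      rw [← PathHom.comap_apply, PathHom.map_symm, PathHom.comap_apply, hα, inv_one]
  have hinj : Function.Injective (Φ.toMonoidHom (j u)) := by
    rw [injective_iff_map_eq_one]
    intro p hp
    induction p using Path.Homotopic.Quotient.ind with | mk p =>
    obtain ⟨α, hα⟩ := h.exists_path_map_homotopic p
    have h1 : q (ψ α.toContinuousMap) = 1 := by
      rw [← hΦ', ← hp]
      exact (Φ.map_homotopic hα).symm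
    -- The loop, pushed into `A`, has the same value as some `β` that dies in `Y`. As `ψ` is
    -- faithful the two are homotopic in `A`, so the original loop dies as well.
    obtain ⟨β, hβ, hβ'⟩ := hkill _ h1
    refine Path.Homotopic.Quotient.eq.mpr (hα.trans ?_)
    exact ((hψ.homotopic hβ.symm).map j).trans (hΨ (β.map j.continuous) hβ')
  have hsurj : Function.Surjective (Φ.toMonoidHom (j u)) := by
    intro x
    obtain ⟨x, rfl⟩ := hq x
    obtain ⟨α, rfl⟩ := hψ' u x
    exact ⟨Path.Homotopic.Quotient.mk (α.map j.continuous), hΦ' α⟩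
  exact ⟨(FundamentalGroup.fundamentalGroupMulEquivOfPathConnected y (j u)).trans
    (MulEquiv.ofBijective _ ⟨hinj, hsurj⟩)⟩

end IsFilling

/-! ### A basis of `ℤ²` adapted to the two tori -/

theorem isCoprime_of_isUnit_of_pow_eq {p q : ℤ}
    (h : ∀ (n : ℤ) (y : Multiplicative (ℤ × ℤ)), y ^ n = .ofAdd (p, q) → IsUnit n) :
    IsCoprime p q := by
  obtain ⟨p', hp⟩ := Int.gcd_dvd_left p q
  obtain ⟨q', hq⟩ := Int.gcd_dvd_right p q
  have hu := h (Int.gcd p q) (.ofAdd (p', q')) (by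
    rw [← ofAdd_zsmul]
    exact congrArg _ (Prod.ext hp.symm hq.symm))
  rw [Int.isCoprime_iff_gcd_eq_one]
  simpa [Int.isUnit_iff_natAbs_eq] using hu

/-- A generator of a direct summand is not a proper power. -/
theorem isUnit_of_zpow_eq_of_isCompl {G : Type*} [CommGroup G] {R K : Subgroup G}
    (hRK : IsCompl R K) (e : R ≃* Multiplicative ℤ) {r : R} (hr : e r = .ofAdd 1) {n : ℤ} {s : G}
    (hs : s ^ n = r) : IsUnit n := by
  obtain ⟨r', hr', k, hk, rfl⟩ := Subgroup.mem_sup.1 (hRK.sup_eq_top ▸ Subgroup.mem_top s)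
  rw [mul_zpow] at hs
  have h1 : k ^ n = (r' ^ n)⁻¹ * r := by rw [← hs, inv_mul_cancel_left]
  -- The `K`-component of `s` has trivial `n`-th power, so `r` is the `n`-th power of an element of
  -- `R`, which is impossible for a generator unless `n` is a unit.
  have h2 : k ^ n ∈ R ⊓ K := ⟨h1 ▸ R.mul_mem (R.inv_mem (R.zpow_mem hr' n)) r.2, K.zpow_mem hk n⟩
  rw [hRK.inf_eq_bot, Subgroup.mem_bot] at h2
  rw [h2, mul_one] at hs
  have h3 : (⟨r', hr'⟩ : R) ^ n = r := Subtype.ext hs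
  rw [← h3, map_zpow] at hr
  refine .of_mul_eq_one (e ⟨r', hr'⟩).toAdd ?_
  have := congrArg Multiplicative.toAdd hr
  rwa [toAdd_zpow, toAdd_ofAdd, smul_eq_mul] at this

/-- The automorphism of `ℤ²` taking `(p, q)` and `(c, d)` to the standard basis. -/
def changeBasis (p q c d : ℤ) : Multiplicative (ℤ × ℤ) →* Multiplicative (ℤ × ℤ) :=
  AddMonoidHom.toMultiplicative
    { toFun := fun x => (d * x.1 - c * x.2, p * x.2 - q * x.1)
      map_zero' := by simp
      map_add' := fun x y => by ext <;> simp <;> ring }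

theorem changeBasis_ofAdd (p q c d m n : ℤ) : changeBasis p q c d (.ofAdd (m, n)) =
    .ofAdd (d * m - c * n, p * n - q * m) := rfl

theorem changeBasis_bijective {p q c d : ℤ} (h : p * d - q * c = 1) :
    Function.Bijective (changeBasis p q c d) := by
  constructor
  · rw [injective_iff_map_eq_one]
    rintro x hx
    obtain ⟨⟨m, n⟩, rfl⟩ := Multiplicative.ofAdd.surjective x
    rw [changeBasis_ofAdd] at hx
    have h1 : d * m - c * n = 0 := congrArg (fun x => (Multiplicative.toAdd x).1) hx
    have h2 : p * n - q * m = 0 := congrArg (fun x => (Multiplicative.toAdd x).2) hx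
    have h3 : m = 0 := by linear_combination p * h1 + c * h2 - m * h
    have h4 : n = 0 := by linear_combination q * h1 + d * h2 - n * h
    rw [h3, h4]
    rfl
  · intro x
    obtain ⟨⟨m, n⟩, rfl⟩ := Multiplicative.ofAdd.surjective x
    refine ⟨.ofAdd (p * m + c * n, q * m + d * n), ?_⟩
    rw [changeBasis_ofAdd]
    congr 2
    · linear_combination m * h
    · linear_combination n * h

namespace PathHom

theorem torusDegree_loopClass (a b : ℤ) :
    torusDegree.toMonoidHom 1 (loopClass (torusCurve a b) (torusCurve_one a b)) = .ofAdd (a, b) :=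
  torusDegree_loop_torusCurve a b

theorem eq_loopClass_torusCurve {ρ : FundamentalGroup Torus 1} {a b : ℤ}
    (h : torusDegree.toMonoidHom 1 ρ = .ofAdd (a, b)) :
    ρ = loopClass (torusCurve a b) (torusCurve_one a b) :=
  torusDegree_isFaithful.toMonoidHom_injective 1 (h.trans (torusDegree_loopClass a b).symm)

/-- If a torus `T` induces an isomorphism on fundamental groups, then the paths in the ambient space
have a bidegree. -/
theorem exists_extension_torusDegree {X : Type*} [TopologicalSpace X] [PathConnectedSpace X]
    (T : C(Torus, X)) (hT : Function.Bijective (FundamentalGroup.map T 1)) :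
    ∃ ψ : PathHom X (Multiplicative (ℤ × ℤ)), ψ.IsFaithful ∧
      ∀ a b, ψ.loop (T.comp (torusCurve a b)) = .ofAdd (a, b) := by
  let f := MulEquiv.ofBijective _ hT
  let g : FundamentalGroup X (T 1) →* Multiplicative (ℤ × ℤ) :=
    (torusDegree.toMonoidHom 1).comp f.symm.toMonoidHom
  have hg : Function.Injective g :=
    (torusDegree_isFaithful.toMonoidHom_injective 1).comp f.symm.injective
  refine ⟨ofMonoidHom g fun y => PathConnectedSpace.somePath _ y, ofMonoidHom_isFaithful _ hg,
    fun a b => ?_⟩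
  have h : T.comp (torusCurve a b) 1 = T 1 := congrArg T (torusCurve_one a b)
  rw [← toMonoidHom_loopClass _ _ h, ofMonoidHom_toMonoidHom,
    ← map_loopClass T (torusCurve a b) (torusCurve_one a b), ← torusDegree_loopClass]
  exact congrArg (torusDegree.toMonoidHom 1)
    (f.symm_apply_apply (loopClass (torusCurve a b) (torusCurve_one a b)))

/-- There are a faithful bidegree for paths and curves on the two tori whose classes are the
standard basis. -/
theorem exists_adapted {X : Type*} [TopologicalSpace X] [PathConnectedSpace X]
    (T₁ T₂ : C(Torus, X))
    (hcyc : Nonempty ((FundamentalGroup.map T₁ 1).range ≃* Multiplicative ℤ))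
    (hsum : ∃ K : Subgroup (FundamentalGroup X (T₁ 1)),
      IsCompl (FundamentalGroup.map T₁ 1).range K)
    (hbij : Function.Bijective (FundamentalGroup.map T₂ 1)) :
    ∃ (ψ : PathHom X (Multiplicative (ℤ × ℤ))) (a b c d : ℤ), ψ.IsFaithful ∧ ψ.IsSurjective ∧
      IsCoprime a b ∧ IsCoprime c d ∧ ψ.loop (T₁.comp (torusCurve a b)) = .ofAdd (1, 0) ∧
      ψ.loop (T₂.comp (torusCurve c d)) = .ofAdd (0, 1) := by
  obtain ⟨ψ, hψ, hψT⟩ := exists_extension_torusDegree T₂ hbij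
  obtain ⟨e⟩ := hcyc
  obtain ⟨K, hK⟩ := hsum
  have hsurj : ψ.IsSurjective := by
    refine ψ.isSurjective_of_toMonoidHom (x := T₂ 1) fun x => ?_
    obtain ⟨⟨a, b⟩, rfl⟩ := Multiplicative.ofAdd.surjective x
    exact ⟨loopClass (T₂.comp (torusCurve a b)) (congrArg T₂ (torusCurve_one a b)), hψT a b⟩
  let G := FundamentalGroup X (T₁ 1)
  let f : G →* Multiplicative (ℤ × ℤ) := ψ.toMonoidHom (T₁ 1)
  have hf : Function.Injective f := hψ.toMonoidHom_injective _
  have hfsurj : Function.Surjective f := fun y => by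
    obtain ⟨s, hs⟩ := hsurj (T₁ 1) y
    exact ⟨Path.Homotopic.Quotient.mk s, hs⟩
  let _ : CommGroup G :=
    { (inferInstance : Group G) with
      mul_comm := fun x y => hf (by rw [map_mul, map_mul, mul_comm]) }
  -- Here `r` generates the image of `π₁(T₁)` and `ρ` is a class on `T₁` mapping to it; `(a, b)` is
  -- the bidegree of `ρ` on `T₁` and `(p, q)` that of `r` in `X`.
  obtain ⟨r, hr⟩ := e.surjective (.ofAdd 1)
  obtain ⟨ρ, hρ⟩ := r.2
  obtain ⟨⟨a, b⟩, hab⟩ := Multiplicative.ofAdd.surjective (torusDegree.toMonoidHom 1 ρ)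
  obtain ⟨⟨p, q⟩, hpq⟩ := Multiplicative.ofAdd.surjective (f r)
  have hρ' := eq_loopClass_torusCurve hab.symm
  -- A root of `ρ` on the torus would map to a root of the generator `r`.
  have hco : IsCoprime a b := by
    refine isCoprime_of_isUnit_of_pow_eq fun n y hy => ?_
    obtain ⟨⟨m, l⟩, rfl⟩ := Multiplicative.ofAdd.surjective y
    have h1 : loopClass (torusCurve m l) (torusCurve_one m l) ^ n = ρ :=
      torusDegree_isFaithful.toMonoidHom_injective 1 (by
        rw [map_zpow, torusDegree_loopClass, hy, hab])
    have h2 : (FundamentalGroup.map T₁ 1).rangeRestrict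
        (loopClass (torusCurve m l) (torusCurve_one m l)) ^ n = r := by
      rw [← map_zpow, h1]
      exact Subtype.ext hρ
    rw [← h2, map_zpow] at hr
    have := congrArg Multiplicative.toAdd hr
    refine .of_mul_eq_one (e ((FundamentalGroup.map T₁ 1).rangeRestrict
      (loopClass (torusCurve m l) (torusCurve_one m l)))).toAdd ?_
    rwa [toAdd_zpow, toAdd_ofAdd, smul_eq_mul] at this
  have hco' : IsCoprime p q := by
    refine isCoprime_of_isUnit_of_pow_eq fun n y hy => ?_
    obtain ⟨s, rfl⟩ := hfsurj y
    have h1 : s ^ n = r := hf (by rw [map_zpow, ← hpq, ← hy])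
    exact isUnit_of_zpow_eq_of_isCompl hK e hr h1
  have hloop : ψ.loop (T₁.comp (torusCurve a b)) = .ofAdd (p, q) := by
    rw [hpq, ← hρ, hρ']
    rfl
  -- From `d * p + c * q = 1`, the vector `(-c, d)` completes `(p, q)` to a basis. It is carried by
  -- a curve on `T₂` because `ψ` was normalized by the bidegree on `T₂`.
  obtain ⟨d, c, hdc⟩ := hco'
  have hbij' := changeBasis_bijective (p := p) (q := q) (c := -c) (d := d) (by linarith)
  refine ⟨ψ.comp (changeBasis p q (-c) d), a, b, -c, d, hψ.comp hbij'.1, hsurj.comp hbij'.2, hco,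
    ⟨-q, p, by linarith⟩, ?_, ?_⟩
  · change changeBasis p q (-c) d (ψ.loop _) = _
    rw [hloop, changeBasis_ofAdd]
    congr 2
    · linarith
    · ring
  · change changeBasis p q (-c) d (ψ.loop _) = _
    rw [hψT, changeBasis_ofAdd]
    congr 2
    · ring
    · linarith

end PathHom

/-! ### Meridians and the boundary circles of the new fibres -/

theorem ContinuousMap.homotopic_of_complex {Y : Type*} [TopologicalSpace Y] (f g : C(Y, ℂ)) :
    f.Homotopic g :=
  ⟨{ toFun := fun x => (1 - ((x.1 : ℝ) : ℂ)) * f x.2 + ((x.1 : ℝ) : ℂ) * g x.2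
     map_zero_left := by simp
     map_one_left := by simp }⟩

section

variable {X : Type u} [TopologicalSpace X] [T2Space X] {ι : Type} [Finite ι]
  [TopologicalSpace ι] [DiscreteTopology ι] {F : ι → C(Torus × ℂ, X)}

/-- The boundary circles of the fibres of a tubular neighbourhood are meridians. -/
theorem IsTubular.isMeridian_fibreCircle [ChartedSpace (EuclideanSpace ℝ (Fin 4)) X]
    (hF : IsTubular F)
    (hF' : ∀ i, IsLocalDiffeomorph (torusModel.prod 𝓘(ℝ, ℂ)) (𝓡 4) ∞ (F i)) (i : ι) (t : Torus) :
    IsMeridian (fun i => core (F i)) i (IsFilling.fibreCircle hF.puncturedTube (i, t)) := by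
  have hsec : ContMDiff 𝓘(ℝ, ℂ) (torusModel.prod 𝓘(ℝ, ℂ)) ∞ fun z : ℂ => (t, z) :=
    contMDiff_const.prodMk contMDiff_id
  have hzero : ContMDiff torusModel (torusModel.prod 𝓘(ℝ, ℂ)) ∞ fun t : Torus => (t, (0 : ℂ)) :=
    contMDiff_id.prodMk contMDiff_const
  refine ⟨(F i).comp ((ContinuousMap.const ℂ t).prodMk (.id ℂ)), (hF' i).contMDiff.comp hsec,
    ⟨t, rfl, ?_⟩, fun z hz => hF.mem_exterior.2 hz, fun s => rfl⟩
  have hd : MDifferentiableAt (torusModel.prod 𝓘(ℝ, ℂ)) (𝓡 4) (F i) (t, 0) :=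
    (hF' i (t, 0)).mdifferentiableAt (by simp)
  have hA : mfderiv torusModel (𝓡 4) (core (F i)) t =
      (mfderiv (torusModel.prod 𝓘(ℝ, ℂ)) (𝓡 4) (F i) (t, 0)).comp
        (mfderiv torusModel (torusModel.prod 𝓘(ℝ, ℂ)) (fun t : Torus => (t, (0 : ℂ))) t) :=
    mfderiv_comp t hd (hzero.mdifferentiableAt (by simp))
  have hB : mfderiv 𝓘(ℝ, ℂ) (𝓡 4) ((F i).comp ((ContinuousMap.const ℂ t).prodMk (.id ℂ))) 0 =
      (mfderiv (torusModel.prod 𝓘(ℝ, ℂ)) (𝓡 4) (F i) (t, 0)).comp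
        (mfderiv 𝓘(ℝ, ℂ) (torusModel.prod 𝓘(ℝ, ℂ)) (fun z : ℂ => (t, z)) 0) :=
    mfderiv_comp (0 : ℂ) hd (hsec.mdifferentiableAt (by simp))
  -- Transversality: the two derivatives are the restrictions of the invertible derivative of `F i`
  -- to the torus and fibre directions, which together span.
  rw [mfderiv_prod_left] at hA
  rw [mfderiv_prod_right] at hB
  rw [eq_top_iff]
  intro w _
  obtain ⟨⟨a, b⟩, rfl⟩ := ((hF' i (t, 0)).mfderivToContinuousLinearEquiv (by simp)).surjective w
  let L : (EuclideanSpace ℝ (Fin 1) × EuclideanSpace ℝ (Fin 1)) × ℂ →L[ℝ]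
    EuclideanSpace ℝ (Fin 4) := mfderiv (torusModel.prod 𝓘(ℝ, ℂ)) (𝓡 4) (F i) (t, 0)
  have hL : L (a, 0) + L (0, b) = L (a, b) := by
    rw [← map_add, Prod.mk_add_mk, add_zero, zero_add]
  exact Submodule.mem_sup.2 ⟨L (a, 0), ⟨a, DFunLike.congr_fun hA a⟩, L (0, b),
    ⟨b, DFunLike.congr_fun hB b⟩, hL⟩

namespace TorusSurgery

/-- The class of the boundary of a new fibre in `X`. -/
theorem loop_fibreCircle_gluing {H : Type*} [CommGroup H] (hF : IsTubular F) {φ : ι → TorusGluing}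
    (ψ : PathHom X H) {p q : ℤ} {γ : C(Circle, Torus)} {i : ι} (hφ : IsSurgeryGluing p q γ (φ i))
    (t : Torus) :
    (ψ.comap (IsTubular.exteriorInclusion F)).loop (IsFilling.fibreCircle (gluing hF φ) (i, t)) =
      ψ.loop ((core (F i)).comp γ) ^ q := by
  let c : C(Circle, ℂ) := ⟨fun s => s, by fun_prop⟩
  let G : C(Torus × Circle, X) := (F i).comp (.prodMk .fst (c.comp .snd))
  let Φ : C(Torus × Circle, Torus × Circle) := ⟨φ i, (φ i).continuous⟩
  have h0 : (IsTubular.exteriorInclusion F).comp (IsFilling.fibreCircle (gluing hF φ) (i, t)) =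
      (G.comp Φ).comp ((ContinuousMap.const Circle t).prodMk (.id Circle)) := by
    ext s
    change F i (radialExtension (φ i) (t, (s : ℂ))) = _
    have := radialExtension_real_mul (φ i) t one_pos s
    rw [Complex.ofReal_one, one_mul, one_mul] at this
    rw [this]
    rfl
  have h1 : ((ContinuousMap.const Circle t).prodMk (.id Circle)).Homotopic
      ((ContinuousMap.const Circle (1 : Torus)).prodMk (.id Circle)) :=
    (ContinuousMap.homotopic_const_iff.2 (PathConnectedSpace.joined t 1)).prodMk (.refl _)
  -- The homotopy crosses the core, which is allowed in `X`. It shrinks the fibre coordinate to `0`,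
  -- so the exponent `p` and the framing disappear from the answer.
  have h2 : G.Homotopic ((core (F i)).comp .fst) := by
    have := (ContinuousMap.Homotopic.refl (F i)).comp ((ContinuousMap.Homotopic.refl
      (ContinuousMap.fst : C(Torus × Circle, Torus))).prodMk
      (ContinuousMap.homotopic_of_complex (c.comp .snd) (.const _ 0)))
    exact this
  have h3 : ((G.comp Φ).comp ((ContinuousMap.const Circle t).prodMk (.id Circle))).Homotopic
      ((core (F i)).comp (γ.comp (circlePow q))) :=
    ((ContinuousMap.Homotopic.refl _).comp h1).trans (h2.comp hφ)
  rw [PathHom.loop_comap, h0, ψ.loop_eq_of_homotopic h3, ← ContinuousMap.comp_assoc,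
    ψ.loop_circlePow]

/-- Connectedness passes from `X` to the exterior by pushing paths off the cores, and from there to
the surgered space. -/
theorem isSmoothFourManifold [ChartedSpace (EuclideanSpace ℝ (Fin 4)) X]
    [IsManifold (𝓡 4) ∞ X] [SecondCountableTopology X] [PathConnectedSpace X] [Nonempty ι]
    (hF : IsTubular F)
    (hF' : ∀ i, IsLocalDiffeomorph (torusModel.prod 𝓘(ℝ, ℂ)) (𝓡 4) ∞ (F i))
    (φ : ι → TorusGluing) : IsSmoothFourManifold F φ := by
  obtain ⟨i⟩ := ‹Nonempty ι›
  have : Nonempty (exterior fun i => core (F i)) :=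
    ⟨⟨F i (1, 1), hF.mem_exterior.2 one_ne_zero⟩⟩
  have := hF.isFilling.pathConnectedSpace_left
  have := (isFilling hF φ).pathConnectedSpace
  have : Nonempty ι := ⟨i⟩
  exact ⟨inferInstance, t2Space hF, secondCountableTopology hF, exists_chartedSpace hF hF'⟩

end TorusSurgery

end

/-! ### The quotient `ℤ/2` and the main theorem -/

/-- Reduction of the second coordinate modulo two. -/
def sndModTwo : Multiplicative (ℤ × ℤ) →* Multiplicative (ZMod 2) :=
  AddMonoidHom.toMultiplicative ((Int.castAddHom (ZMod 2)).comp (AddMonoidHom.snd ℤ ℤ))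

theorem sndModTwo_surjective : Function.Surjective sndModTwo := by
  intro x
  obtain ⟨n, hn⟩ := ZMod.intCast_surjective x.toAdd
  exact ⟨.ofAdd (0, n), congrArg Multiplicative.ofAdd hn⟩

theorem sndModTwo_ker :
    sndModTwo.ker = Subgroup.closure {.ofAdd (1, 0), .ofAdd (0, 2)} := by
  apply le_antisymm
  · intro x hx
    obtain ⟨⟨m, n⟩, rfl⟩ := Multiplicative.ofAdd.surjective x
    have h : ((n : ℤ) : ZMod 2) = 0 := congrArg Multiplicative.toAdd (MonoidHom.mem_ker.1 hx)
    obtain ⟨l, rfl⟩ := (ZMod.intCast_zmod_eq_zero_iff_dvd n 2).1 h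
    have h1 : (Multiplicative.ofAdd (m, ((2 : ℕ) : ℤ) * l) : Multiplicative (ℤ × ℤ)) =
        .ofAdd (1, 0) ^ m * .ofAdd (0, 2) ^ l := by
      rw [← ofAdd_zsmul, ← ofAdd_zsmul, ← ofAdd_add]
      congr 1
      ext <;> simp [mul_comm]
    rw [h1]
    exact Subgroup.mul_mem _ (Subgroup.zpow_mem _ (Subgroup.subset_closure (by simp)) m)
      (Subgroup.zpow_mem _ (Subgroup.subset_closure (by simp)) l)
  · rw [Subgroup.closure_le]
    rintro x (rfl | rfl)
    · exact congrArg Multiplicative.ofAdd (by simp)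
    · exact congrArg Multiplicative.ofAdd (by decide)

theorem mainTheorem7 {X : Type u} [TopologicalSpace X] [T2Space X] [SecondCountableTopology X]
    [ConnectedSpace X] [ChartedSpace (EuclideanSpace ℝ (Fin 4)) X] [IsManifold (𝓡 4) ∞ X]
    (Ω : ∀ x : X, TangentSpace (𝓡 4) x [⋀^Fin 2]→L[ℝ] ℝ) (T₁ T₂ : C(Torus, X))
    (hT : IsTelescopingTriple Ω T₁ T₂) :
    ∃ γ₁ γ₂ : C(Circle, Torus), IsPrimitiveCurve γ₁ ∧ IsPrimitiveCurve γ₂ ∧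
      (∃ φ₁ : TorusGluing, IsSurgeryGluing 1 1 γ₁ φ₁) ∧
      (∃ φ₂ : TorusGluing, IsSurgeryGluing 1 2 γ₂ φ₂) ∧
      ∀ F₁ F₂ : C(Torus × ℂ, X), IsFraming T₁ F₁ → IsFraming T₂ F₂ →
        Disjoint (range F₁) (range F₂) →
        ∀ φ₁ φ₂ : TorusGluing, IsSurgeryGluing 1 1 γ₁ φ₁ → IsSurgeryGluing 1 2 γ₂ φ₂ →
          TorusSurgery.IsSmoothFourManifold ![F₁, F₂] ![φ₁, φ₂] ∧
          ∀ x : TorusSurgery ![F₁, F₂] ![φ₁, φ₂],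
            Nonempty (FundamentalGroup (TorusSurgery ![F₁, F₂] ![φ₁, φ₂]) x ≃*
              Multiplicative (ZMod 2)) := by
  have := ChartedSpace.locallyPathConnectedSpace (EuclideanSpace ℝ (Fin 4)) X
  have : PathConnectedSpace X := pathConnectedSpace_iff_connectedSpace.2 inferInstance
  obtain ⟨ψ, a, b, c, d, hψ, hψ', hab, hcd, h₁, h₂⟩ :=
    PathHom.exists_adapted T₁ T₂ hT.range_cyclic hT.range_summand hT.bijective
  refine ⟨torusCurve a b, torusCurve c d, torusCurve_isPrimitiveCurve hab,
    torusCurve_isPrimitiveCurve hcd, exists_isSurgeryGluing hab 1, exists_isSurgeryGluing hcd 2, ?_⟩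
  intro F₁ F₂ hF₁ hF₂ hd φ₁ φ₂ hφ₁ hφ₂
  have hF : IsTubular ![F₁, F₂] := by
    refine ⟨Fin.forall_fin_two.2 ⟨hF₁.isOpenEmbedding, hF₂.isOpenEmbedding⟩, ?_⟩
    rintro i j hij
    fin_cases i <;> fin_cases j
    exacts [absurd rfl hij, hd, hd.symm, absurd rfl hij]
  have hF' : ∀ i, IsLocalDiffeomorph (torusModel.prod 𝓘(ℝ, ℂ)) (𝓡 4) ∞ (![F₁, F₂] i) :=
    Fin.forall_fin_two.2 ⟨hF₁.isLocalDiffeomorph, hF₂.isLocalDiffeomorph⟩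
  have hsmooth := TorusSurgery.isSmoothFourManifold hF hF' ![φ₁, φ₂]
  refine ⟨hsmooth, ?_⟩
  have hcore : ![T₁, T₂] = fun i => core (![F₁, F₂] i) := by
    funext i
    fin_cases i
    exacts [hF₁.core_eq.symm, hF₂.core_eq.symm]
  have hmer : ∀ i (m : C(Circle, exterior fun i => core (![F₁, F₂] i))),
      IsMeridian (fun i => core (![F₁, F₂] i)) i m → m.Nullhomotopic := hcore ▸ hT.meridian
  have : Nonempty (exterior fun i => core (![F₁, F₂] i)) :=
    ⟨⟨F₁ (1, 1), hF.mem_exterior (i := 0).2 one_ne_zero⟩⟩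
  have := hF.isFilling.pathConnectedSpace_left
  -- The bidegree `ψ` of `X` restricts to a faithful and surjective one on the exterior, because the
  -- fibre circles of the old tubes are meridians. It remains to see that the new fibre circles
  -- generate the kernel of `sndModTwo`.
  refine (TorusSurgery.isFilling hF ![φ₁, φ₂]).nonempty_fundamentalGroup_mulEquiv
    (hF.isFilling.isFaithful_comap
      (fun ⟨i, t⟩ => hmer i _ (hF.isMeridian_fibreCircle hF' i t)) hψ)
    (hF.isFilling.isSurjective_comap hψ') sndModTwo_surjective ?_
  have hc₁ (t : Torus) : (ψ.comap (IsTubular.exteriorInclusion ![F₁, F₂])).loop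
      (IsFilling.fibreCircle (TorusSurgery.gluing hF ![φ₁, φ₂]) (0, t)) = .ofAdd (1, 0) := by
    rw [TorusSurgery.loop_fibreCircle_gluing hF (φ := ![φ₁, φ₂]) ψ (i := 0) hφ₁ t, zpow_one, ← h₁,
      ← hF₁.core_eq]
    rfl
  have hc₂ (t : Torus) : (ψ.comap (IsTubular.exteriorInclusion ![F₁, F₂])).loop
      (IsFilling.fibreCircle (TorusSurgery.gluing hF ![φ₁, φ₂]) (1, t)) = .ofAdd (0, 2) := by
    rw [TorusSurgery.loop_fibreCircle_gluing hF (φ := ![φ₁, φ₂]) ψ (i := 1) hφ₂ t]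
    change ψ.loop ((core F₂).comp _) ^ (2 : ℤ) = _
    rw [hF₂.core_eq, h₂]
    rfl
  rw [sndModTwo_ker]
  congr 1
  ext x
  constructor
  -- The class of a new fibre circle does not depend on the point `t` of the torus, so exactly two
  -- values occur.
  · rintro (rfl | rfl)
    exacts [⟨(0, 1), hc₁ 1⟩, ⟨(1, 1), hc₂ 1⟩]
  · rintro ⟨⟨i, t⟩, rfl⟩
    fin_cases i
    exacts [.inl (hc₁ t), .inr (hc₂ t)]

end
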